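/- Let $\kappa$ be a strongly inaccessible cardinal and let $\mathcal F$ be a proper, non-principal, $\kappa$-complete normal filter on $\kappa$ (non-principal: not of the form $\{X\subseteq\kappa : Y\subseteq X\}$; $\kappa$-complete: closed under intersections of fewer than $\kappa$ members; normal: closed under diagonal intersections $\{\beta<\kappa:\forall\alpha<\beta\;\beta\in A_\alpha\}$ of sequences $(A_\alpha:\alpha<\kappa)$ from $\mathcal F$). Generalized Miller forcing $\mathbb{MI}_\kappa^{\mathcal F}$ consists of all nonempty trees $T\subseteq\kappa^{<\kappa}$ (closed under initial segments) of strictly increasing sequences such that, where $\mathrm{succ}_T(u)=\{\beta<\kappa: u^\frown\beta\in T\}$ and $u\in T$ is said to split in $T$ if $\mathrm{succ}_T(u)\in\mathcal F$: (1) every $u\in T$ has an extension in $T$ that splits in $T$, and $|\mathrm{succ}_T(u)|=1$ if $u\in T$ does not split; (2) if $\alpha<\kappa$ is a limit ordinal, $u\in\kappa^\alpha$ and $u\restriction\beta\in T$ for all $\beta<\alpha$, then $u\in T$; (3) if $\alpha<\kappa$ is a limit ordinal, $u\in\kappa^\alpha$ and $u\restriction\beta$ splits in $T$ for arbitrarily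 large $\beta<\alpha$, then $u$ splits in $T$. The order is inclusion: $T\le S$ iff $T\subseteq S$. Let $\mathbb Q^*=\mathbb{MI}_\kappa^{\mathcal F}\times\mathbb{MI}_\kappa^{\mathcal F}$, ordered coordinatewise. Let $G$ be $\mathbb Q^*$-generic over $V$, let $G_0,G_1$ be its projections to the two factors, and let $m_i$ be given by $\bigcap\{T:T\in G_i\}$ (the set of all initial segments of $m_i$). Call $\alpha<\kappa$ an oscillation point of $m_0,m_1$ if there is $\gamma<\alpha$ such that either $m_0(\alpha)>m_1(\alpha)$ and $m_0(\beta)<m_1(\beta)$ for all $\beta\in[\gamma,\alpha)$, or $m_1(\alpha)>m_0(\alpha)$ and $m_1(\beta)<m_0(\beta)$ for all $\beta\in[\gamma,\alpha)$. Let $A$ be the set of oscillation points and $C$ the set of limit points of $A$ below $\kappa$, that is, of all $\delta$ with $0<\delta<\kappa$ such that $A\cap\delta$ is unbounded in $\delta$. Then in $V[G]$: $m_0$ and $m_1$ are functions from $\kappa$ to $\kappa$; $A$ is unbounded in $\kappa$ and $C$ is club in $\kappa$; $C$ has a continuous increasing enumeration $(\gamma_\alpha:\alpha<\kappa)$; and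 the function $c:\kappa\to2$ with $c(\alpha)=0$ if $m_0(\gamma_\alpha)\le m_1(\gamma_\alpha)$ and $c(\alpha)=1$ if $m_0(\gamma_\alpha)>m_1(\gamma_\alpha)$ is a $\kappa$-Cohen function over $V$, i.e. $c=\bigcup H$ for a filter $H$ that is generic over $V$ for $\mathbb C_\kappa=\mathrm{Fn}(\kappa,2,\kappa)$, the partial functions from $\kappa$ to $2$ with domain of size less than $\kappa$, ordered by reverse inclusion. In particular $\mathbb Q^*$ adds a $\kappa$-Cohen function. -/

import Mathlib

universe u v w

/-! ### Forcing

`P` is a forcing notion (a preorder, smaller conditions are stronger), the ground model is the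
ambient universe. A sentence of the forcing language is represented by the predicate "`p` forces
it"; the operations below are the usual clauses of the definition of the forcing relation. -/

namespace Forcing

/-- A sentence of the forcing language, given by the conditions which force it. -/
abbrev Sentence (P : Type u) := P → Prop

section Connectives

variable {P : Type u} [Preorder P]

/-- A sentence about the ground model. -/
def ground (a : Prop) : Sentence P := fun _ => a

def neg (φ : Sentence P) : Sentence P := fun p => ∀ q ≤ p, ¬ φ q

def conj (φ ψ : Sentence P) : Sentence P := fun p => φ p ∧ ψ p

def imp (φ ψ : Sentence P) : Sentence P := fun p => ∀ q ≤ p, φ q → ψ q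

def iff (φ ψ : Sentence P) : Sentence P := conj (imp φ ψ) (imp ψ φ)

/-- A disjunction is forced by `p` if densely many conditions below `p` force a disjunct. -/
def disj (φ ψ : Sentence P) : Sentence P := fun p => ∀ q ≤ p, ∃ r ≤ q, φ r ∨ ψ r

/-- Universal quantification over a set `X` of the ground model. -/
def all {X : Type v} (φ : X → Sentence P) : Sentence P := fun p => ∀ x, φ x p

/-- Existential quantification over a set `X` of the ground model. -/
def ex {X : Type v} (φ : X → Sentence P) : Sentence P := fun p => ∀ q ≤ p, ∃ r ≤ q, ∃ x, φ x r

/-- The sentence is forced by every condition, i.e. it holds in every generic extension. -/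
def Forced (φ : Sentence P) : Prop := ∀ p, φ p

end Connectives

/-- A `P`-name for a subset of the ground model set `X`: a set of pairs `(x, p)`, where `x` stands
for its own canonical name. -/
abbrev SetName (P : Type u) (X : Type v) := Set (X × P)

section Names

variable {P : Type u} [Preorder P] {X : Type v} {Y : Type w}

/-- The sentence `x ∈ τ`: densely many conditions lie below some `t` with `(x, t) ∈ τ`. -/
def mem (τ : SetName P X) (x : X) : Sentence P :=
  fun p => ∀ q ≤ p, ∃ r ≤ q, ∃ t, (x, t) ∈ τ ∧ r ≤ t

/-- The name for `{x ∈ X : φ x}`. -/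
def sep (φ : X → Sentence P) : SetName P X := {a | φ a.1 a.2}

/-- The canonical name for the generic filter. -/
def genericFilter (P : Type u) : SetName P P := {a | a.1 = a.2}

/-- The sentence "`f` is (the graph of) a function from `X` to `Y`". -/
def isFunction (f : SetName P (X × Y)) : Sentence P :=
  all fun x : X => ex fun y : Y =>
    conj (mem f (x, y)) (all fun y' : Y => imp (mem f (x, y')) (ground (y' = y)))

/-- The sentence `R (f x) (g x)`. -/
def valRel (R : Y → Y → Prop) (f g : SetName P (X × Y)) (x : X) : Sentence P :=
  ex fun a : Y => ex fun b : Y => conj (mem f (x, a)) (conj (mem g (x, b)) (ground (R a b)))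

/-- `D` is dense in the forcing notion. -/
def IsDense (D : Set P) : Prop := ∀ p, ∃ q ∈ D, q ≤ p

/-- `H` is forced to be a filter on the ground model forcing notion `R` which meets all dense
subsets of `R` lying in the ground model. -/
def IsGenericName {R : Type v} [Preorder R] (H : SetName P R) : Prop :=
  Forced (all fun r : R => all fun s : R => imp (conj (mem H r) (ground (r ≤ s))) (mem H s)) ∧
  Forced (all fun r : R => all fun s : R => imp (conj (mem H r) (mem H s))
    (ex fun t : R => conj (mem H t) (ground (t ≤ r ∧ t ≤ s)))) ∧
  ∀ D : Set R, IsDense D → Forced (ex fun d : R => conj (ground (d ∈ D)) (mem H d))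

/-- The first factor of a name for a subset of a product. -/
def fstProj (H : SetName P (X × Y)) : SetName P X := sep fun x => ex fun y : Y => mem H (x, y)

/-- The second factor of a name for a subset of a product. -/
def sndProj (H : SetName P (X × Y)) : SetName P Y := sep fun y => ex fun x : X => mem H (x, y)

end Names

end Forcing

namespace KappaForcing

open Forcing

/-- The cardinal `κ` as the set of all ordinals below it. -/
abbrev Below (κ : Cardinal.{u}) := Set.Iio κ.ord

/-! ### Subsets of `κ` in the extension -/

section SubsetsOfKappa

variable {P : Type v} [Preorder P] {κ : Cardinal.{u}}

/-- The set of those `0 < δ < κ` for which `A ∩ δ` is unbounded in `δ`. -/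
def limitPoints (A : SetName P (Below κ)) : SetName P (Below κ) :=
  sep fun δ => conj (ground (0 < (δ : Ordinal)))
    (all fun ξ : Below κ => imp (ground (ξ < δ))
      (ex fun α : Below κ => conj (ground (ξ < α ∧ α < δ)) (mem A α)))

def isUnbounded (A : SetName P (Below κ)) : Sentence P :=
  all fun ξ : Below κ => ex fun α : Below κ => conj (ground (ξ < α)) (mem A α)

/-- The sentence "`C` is closed and unbounded in `κ`". -/
def isClub (C : SetName P (Below κ)) : Sentence P :=
  conj (isUnbounded C) (all fun δ : Below κ => imp (mem (limitPoints C) δ) (mem C δ))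

/-- The sentence "`e : κ → κ` is the continuous increasing enumeration of `C`". -/
def isEnumeration (e : SetName P (Below κ × Below κ)) (C : SetName P (Below κ)) : Sentence P :=
  conj (isFunction e) <|
  conj (all fun α : Below κ => all fun β : Below κ => imp (ground (α < β))
    (ex fun a : Below κ => ex fun b : Below κ =>
      conj (mem e (α, a)) (conj (mem e (β, b)) (ground (a < b))))) <|
  conj (all fun δ : Below κ => iff (mem C δ) (ex fun α : Below κ => mem e (α, δ))) <|
  all fun l : Below κ => all fun δ : Below κ => all fun ξ : Below κ =>
    imp (conj (ground (Order.IsSuccLimit (l : Ordinal) ∧ ξ < δ)) (mem e (l, δ)))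
      (ex fun α : Below κ => ex fun η : Below κ =>
        conj (mem e (α, η)) (ground (α < l ∧ ξ < η)))

end SubsetsOfKappa

/-! ### Generalized Cohen forcing -/

/-- The partial functions from `κ` to `2` whose domain has size less than `κ`. -/
structure CohenCond (κ : Cardinal.{u}) where
  val : Below κ → Option (Fin 2)
  card_dom_lt : Cardinal.mk {α | val α ≠ none} < Cardinal.lift.{u + 1} κ

/-- Cohen conditions are ordered by reverse inclusion. -/
instance (κ : Cardinal.{u}) : Preorder (CohenCond κ) where
  le s t := ∀ α i, t.val α = some i → s.val α = some i
  le_refl _ _ _ h := h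
  le_trans _ _ _ h₁ h₂ α i h := h₁ α i (h₂ α i h)

/-- `c` is a name for a `κ`-Cohen function over the ground model: it is forced to be the union of
a generic filter of generalized Cohen forcing. -/
def IsCohenName {P : Type v} [Preorder P] {κ : Cardinal.{u}}
    (c : SetName P (Below κ × Fin 2)) : Prop :=
  ∃ H : SetName P (CohenCond κ), IsGenericName H ∧
    Forced (all fun α : Below κ => all fun i : Fin 2 =>
      iff (mem c (α, i)) (ex fun s : CohenCond κ => conj (mem H s) (ground (s.val α = some i))))

/-! ### Generalized Miller forcing -/

/-- A filter on `κ` is normal if it is closed under diagonal intersections. -/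
def IsNormalFilter {κ : Cardinal.{u}} (F : Filter (Below κ)) : Prop :=
  ∀ A : Below κ → Set (Below κ), (∀ α, A α ∈ F) → {β | ∀ α < β, β ∈ A α} ∈ F

/-- The elements of `κ^{<κ}`: sequences of ordinals below `κ` whose length `len` is below `κ`.
The values at arguments outside the domain `len` are set to `0`, so that equality of nodes is
equality of sequences. -/
@[ext]
structure Node (κ : Cardinal.{u}) where
  len : Ordinal.{u}
  val : Ordinal.{u} → Ordinal.{u}
  len_lt : len < κ.ord
  val_lt : ∀ ξ < len, val ξ < κ.ord
  val_eq_zero : ∀ ξ, len ≤ ξ → val ξ = 0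

namespace Node

variable {κ : Cardinal.{u}}

/-- `u ⊆ v` for sequences `u`, `v`. -/
def IsInit (u v : Node κ) : Prop := u.len ≤ v.len ∧ ∀ ξ < u.len, u.val ξ = v.val ξ

/-- The restriction of `u` to `α`. -/
noncomputable def restrict (u : Node κ) (α : Ordinal.{u}) : Node κ where
  len := min u.len α
  val ξ := open Classical in if ξ < α then u.val ξ else 0
  len_lt := (min_le_left _ _).trans_lt u.len_lt
  val_lt ξ h := by
    rw [if_pos (h.trans_le (min_le_right _ _))]
    exact u.val_lt ξ (h.trans_le (min_le_left _ _))
  val_eq_zero ξ h := by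
    split_ifs with h'
    · exact u.val_eq_zero ξ ((min_le_iff.1 h).resolve_right (not_le.2 h'))
    · rfl

/-- `v` is the sequence `u` followed by the single entry `β`. -/
def IsSnoc (u : Node κ) (β : Ordinal.{u}) (v : Node κ) : Prop :=
  v.len = Order.succ u.len ∧ u.IsInit v ∧ v.val u.len = β

def IsStrictlyIncreasing (u : Node κ) : Prop :=
  ∀ ξ η, ξ < η → η < u.len → u.val ξ < u.val η

end Node

section Miller

variable {κ : Cardinal.{u}}

/-- The set of all `β < κ` such that `u` followed by `β` belongs to `T`. -/
def succSet (T : Set (Node κ)) (u : Node κ) : Set (Below κ) :=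
  {β | ∃ v ∈ T, u.IsSnoc β v}

/-- `u` is an element of `T` which `F`-splits in `T`. -/
def Splits (F : Filter (Below κ)) (T : Set (Node κ)) (u : Node κ) : Prop :=
  u ∈ T ∧ succSet T u ∈ F

/-- `T` is a condition of generalized Miller forcing with the filter `F`. -/
structure IsMillerTree (F : Filter (Below κ)) (T : Set (Node κ)) : Prop where
  nonempty : T.Nonempty
  isTree : ∀ u v : Node κ, v ∈ T → u.IsInit v → u ∈ T
  strictlyIncreasing : ∀ u ∈ T, u.IsStrictlyIncreasing
  exists_splits : ∀ u ∈ T, ∃ t, u.IsInit t ∧ Splits F T t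
  unique_succ : ∀ u ∈ T, ¬ Splits F T u → ∃! β, β ∈ succSet T u
  limit_mem : ∀ u : Node κ, Order.IsSuccLimit u.len → (∀ β < u.len, u.restrict β ∈ T) → u ∈ T
  limit_splits : ∀ u : Node κ, Order.IsSuccLimit u.len →
    (∀ ξ < u.len, ∃ β, ξ ≤ β ∧ β < u.len ∧ Splits F T (u.restrict β)) → Splits F T u

/-- Generalized Miller forcing with the filter `F`, ordered by inclusion. -/
abbrev Miller (F : Filter (Below κ)) := {T : Set (Node κ) // IsMillerTree F T}

variable {F : Filter (Below κ)} {P : Type v} [Preorder P]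

/-- The Miller function given by a name `G` for a filter on Miller forcing: the function whose
initial segments are the elements of `⋂ {T : T ∈ G}`. -/
def millerFunction (G : SetName P (Miller F)) : SetName P (Below κ × Below κ) :=
  sep fun a => ex fun u : Node κ =>
    conj (all fun T : Miller F => imp (mem G T) (ground (u ∈ T.1)))
      (ground ((a.1 : Ordinal) < u.len ∧ u.val a.1 = a.2))

/-- The first Miller function added by the product of two copies of Miller forcing. -/
def m₀ (F : Filter (Below κ)) : SetName (Miller F × Miller F) (Below κ × Below κ) :=
  millerFunction (fstProj (genericFilter (Miller F × Miller F)))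

/-- The second Miller function added by the product of two copies of Miller forcing. -/
def m₁ (F : Filter (Below κ)) : SetName (Miller F × Miller F) (Below κ × Below κ) :=
  millerFunction (sndProj (genericFilter (Miller F × Miller F)))

end Miller

/-! ### Oscillation -/

section Oscillation

variable {κ : Cardinal.{u}} {P : Type v} [Preorder P]

/-- The sentence "`f α > g α`, and `f β < g β` for all `γ ≤ β < α`". -/
def crossesAt (f g : SetName P (Below κ × Below κ)) (γ α : Below κ) : Sentence P :=
  conj (valRel (· > ·) f g α)
    (all fun β : Below κ => imp (ground (γ ≤ β ∧ β < α)) (valRel (· < ·) f g β))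

/-- The set of oscillation points of `f` and `g`. -/
def oscPoints (f g : SetName P (Below κ × Below κ)) : SetName P (Below κ) :=
  sep fun α => ex fun γ : Below κ =>
    conj (ground (γ < α)) (disj (crossesAt f g γ α) (crossesAt g f γ α))

/-- The function `c : κ → 2` with `c α = 0` if `f (e α) ≤ g (e α)` and `c α = 1` if
`f (e α) > g (e α)`. -/
def oscFunction (f g e : SetName P (Below κ × Below κ)) : SetName P (Below κ × Fin 2) :=
  sep fun a => ex fun δ : Below κ => conj (mem e (a.1, δ))
    (disj (conj (ground (a.2 = 0)) (valRel (· ≤ ·) f g δ))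
      (conj (ground (a.2 = 1)) (valRel (· > ·) f g δ)))

end Oscillation

end KappaForcing

open Cardinal Ordinal

namespace KappaForcing

open Forcing

variable {κ : Cardinal.{u}}

/-! The filter contains all final segments of `κ` (`IsMillerTree.Ioi_mem`), so a splitting node of
one tree can be extended to overtake any given splitting node of the other
(`IsMillerTree.exists_dominating`). Letting two nodes overtake each other in turn `ω` times produces
unions that split again, by the closure of splitting under limits. Their common length is the first
limit of oscillation points above the starting length (`Interleaved.exists_next_oscLim`).

Now let two nodes split at a common length `γ_β` in `C`. The values there are still open, so either
function can be made the larger one at `γ_β`, after which the construction runs to the next element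
of `C`: the bit `c(β)` is free (`GoodPair.exists_next`). Iterating with unions at limit stages,
where regularity of `κ` keeps lengths below `κ`, realizes any prescribed block of fewer than `κ`
bits (`GoodPair.exists_realizes`).

Passing to the subtrees of nodes comparable with such a pair gives a condition that decides both
functions, and hence all oscillation below that length (`Decides`, `Eval`). Thus every condition has
an ordinal `β₀` and a pattern `t` on `β₀` such that each continuation of `t` to a longer bounded
length is realized by a stronger condition (`exists_le_decides_highAt`). Given a dense set of Cohen
conditions, extend `t` into it and realize the result (`exists_dense_mem_cohenFilter`): the Cohen
conditions contained in `c` form a generic filter. -/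

theorem mk_Iic_lt_lift (hκ : κ.IsInaccessible) (α : Below κ) :
    #(Set.Iic α) < Cardinal.lift.{u + 1} κ := by
  have hlim := Cardinal.isSuccLimit_ord hκ.aleph0_lt.le
  calc #(Set.Iic α) ≤ #(Set.Iio (Order.succ (α : Ordinal.{u}))) :=
        Cardinal.mk_le_of_injective (f := fun x : Set.Iic α =>
          (⟨x.1.1, Set.mem_Iio.2 (Order.lt_succ_of_le (Subtype.coe_le_coe.2 (Set.mem_Iic.1 x.2)))⟩ :
            Set.Iio (Order.succ (α : Ordinal.{u}))))
          fun x y h => Subtype.ext (Subtype.ext (congrArg (fun z => z.1) h))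
    _ < Cardinal.lift.{u + 1} κ := by
      rw [Cardinal.mk_Iio_ordinal, Cardinal.lift_lt, ← Cardinal.lt_ord]
      exact hlim.succ_lt α.2

/-- Fewer than `κ` ordinals below `κ` are bounded below `κ`. -/
theorem exists_bound_of_mk_lt (hκ : κ.IsInaccessible) {ι : Type w} (f : ι → Ordinal.{u})
    (hι : Cardinal.lift.{u} #ι < Cardinal.lift.{w} κ) (hf : ∀ i, f i < κ.ord) :
    ∃ μ < κ.ord, ∀ i, f i ≤ μ := by
  refine ⟨iSup f, Ordinal.lift_iSup_lt_of_lt_cof ?_ hf, fun i =>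
    le_ciSup ⟨κ.ord, by rintro _ ⟨i, rfl⟩; exact (hf i).le⟩ i⟩
  rwa [← Ordinal.lift_cof, hκ.isRegular.cof_ord]

/-! ### Nodes -/

namespace Node

/-- Nodes are ordered by end-extension. -/
instance : PartialOrder (Node κ) where
  le := IsInit
  le_refl u := ⟨le_rfl, fun _ _ => rfl⟩
  le_trans u v w h₁ h₂ :=
    ⟨h₁.1.trans h₂.1, fun ξ h => (h₁.2 ξ h).trans (h₂.2 ξ (h.trans_le h₁.1))⟩
  le_antisymm u v h₁ h₂ := by
    have hl : u.len = v.len := h₁.1.antisymm h₂.1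
    refine Node.ext hl (funext fun ξ => ?_)
    rcases lt_or_ge ξ u.len with h | h
    · exact h₁.2 ξ h
    · rw [u.val_eq_zero ξ h, v.val_eq_zero ξ (hl ▸ h)]

theorem len_le {u v : Node κ} (h : u ≤ v) : u.len ≤ v.len := h.1

theorem val_eq {u v : Node κ} (h : u ≤ v) {ξ : Ordinal.{u}} (hξ : ξ < u.len) :
    u.val ξ = v.val ξ := h.2 ξ hξ

theorem eq_of_le_of_len_le {u v : Node κ} (h : u ≤ v) (hl : v.len ≤ u.len) : u = v :=
  le_antisymm h ⟨hl, fun _ hξ => (h.2 _ (hξ.trans_le hl)).symm⟩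

theorem le_of_le_of_le {u v w : Node κ} (hu : u ≤ w) (hv : v ≤ w) (hl : u.len ≤ v.len) : u ≤ v :=
  ⟨hl, fun _ hξ => (hu.2 _ hξ).trans (hv.2 _ (hξ.trans_le hl)).symm⟩

theorem restrict_val_of_lt (u : Node κ) {α ξ : Ordinal.{u}} (h : ξ < α) :
    (u.restrict α).val ξ = u.val ξ := if_pos h

theorem restrict_le (u : Node κ) (α : Ordinal.{u}) : u.restrict α ≤ u :=
  ⟨min_le_left _ _, fun _ hξ => u.restrict_val_of_lt (hξ.trans_le (min_le_right _ _))⟩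

theorem restrict_len {u : Node κ} {α : Ordinal.{u}} (h : α ≤ u.len) : (u.restrict α).len = α :=
  min_eq_right h

theorem restrict_of_le {u v : Node κ} (h : u ≤ v) : v.restrict u.len = u :=
  eq_of_le_of_len_le (le_of_le_of_le (restrict_le _ _) h (min_le_right _ _))
    (restrict_len (len_le h)).ge

theorem restrict_le_of_le {u v : Node κ} (h : u ≤ v) {α : Ordinal.{u}} (hα : α ≤ u.len) :
    v.restrict α ≤ u :=
  le_of_le_of_le (restrict_le _ _) h ((min_le_right _ _).trans hα)

/-- A chain of nodes of bounded length has a union. -/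
theorem exists_union (c : Set (Node κ)) (hc : IsChain (· ≤ ·) c) {μ : Ordinal.{u}}
    (hμ : μ < κ.ord) (hb : ∀ v ∈ c, v.len ≤ μ) :
    ∃ w : Node κ, w.len ≤ μ ∧ (∀ v ∈ c, v ≤ w) ∧ ∀ ξ < w.len, ∃ v ∈ c, ξ < v.len := by
  classical
  have hbd : BddAbove (len '' c) := ⟨μ, by rintro _ ⟨v, hv, rfl⟩; exact hb v hv⟩
  have hlt : ∀ ξ < sSup (len '' c), ∃ v, v ∈ c ∧ ξ < v.len := by
    intro ξ hξ
    obtain ⟨_, ⟨v, hv, rfl⟩, h⟩ := exists_lt_of_lt_csSup' hξ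
    exact ⟨v, hv, h⟩
  have hle : sSup (len '' c) ≤ μ := csSup_le' (by rintro _ ⟨v, hv, rfl⟩; exact hb v hv)
  -- Any member of the chain reaching past `ξ` gives the same value. The default `0` is the one that
  -- `val_eq_zero` demands.
  refine ⟨⟨sSup (len '' c), fun ξ => if h : ∃ v, v ∈ c ∧ ξ < v.len then h.choose.val ξ else 0,
    hle.trans_lt hμ, ?_, ?_⟩, hle, ?_, ?_⟩
  · intro ξ hξ
    have h := hlt ξ hξ
    rw [dif_pos h]
    exact h.choose.val_lt ξ h.choose_spec.2
  · intro ξ hξ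
    refine dif_neg ?_
    rintro ⟨v, hv, h⟩
    exact (h.trans_le (le_csSup hbd ⟨v, hv, rfl⟩)).not_ge hξ
  · intro v hv
    refine ⟨le_csSup hbd ⟨v, hv, rfl⟩, fun ξ hξ => ?_⟩
    have h : ∃ v, v ∈ c ∧ ξ < v.len := ⟨v, hv, hξ⟩
    simp only [dif_pos h]
    rcases hc.total hv h.choose_spec.1 with h' | h'
    · exact val_eq h' hξ
    · exact (val_eq h' h.choose_spec.2).symm
  · intro ξ hξ
    obtain ⟨v, hv, h⟩ := hlt ξ hξ
    exact ⟨v, hv, h⟩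

end Node

theorem le_of_isSnoc {u v : Node κ} {β : Ordinal.{u}} (h : u.IsSnoc β v) : u ≤ v := h.2.1

/-! ### Miller trees -/

section Tree

variable {F : Filter (Below κ)} {T S : Set (Node κ)}

theorem IsMillerTree.mem_of_le (hT : IsMillerTree F T) {u v : Node κ} (hv : v ∈ T) (h : u ≤ v) :
    u ∈ T := hT.isTree u v hv h

/-- Closure under unions without a case split on the length of `w`: at a successor length the
approximation past the last place is `w` itself, and at a limit the tree is closed. -/
theorem IsMillerTree.mem_of_approx (hT : IsMillerTree F T) {w : Node κ}
    (h : ∀ ξ < w.len, ∃ v ∈ T, v ≤ w ∧ ξ < v.len) : w ∈ T := by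
  rcases Ordinal.zero_or_succ_or_isSuccLimit w.len with h0 | ⟨a, ha⟩ | hl
  · obtain ⟨u, hu⟩ := hT.nonempty
    exact hT.mem_of_le hu ⟨h0 ▸ zero_le, fun ξ hξ => absurd (h0 ▸ hξ) not_lt_zero⟩
  · obtain ⟨v, hv, hvw, hξ⟩ := h a (ha ▸ Order.lt_succ a)
    rwa [← Node.eq_of_le_of_len_le hvw (ha ▸ Order.succ_le_of_lt hξ)]
  · refine hT.limit_mem w hl fun β hβ => ?_
    obtain ⟨v, hv, hvw, hξ⟩ := h β hβ
    exact hT.mem_of_le hv (Node.restrict_le_of_le hvw hξ.le)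

/-- The approximations are proper initial segments, which forces `w` to have limit length. -/
theorem IsMillerTree.splits_of_approx (hT : IsMillerTree F T) {w : Node κ}
    (h0 : w.len ≠ 0) (h : ∀ ξ < w.len, ∃ v, Splits F T v ∧ v ≤ w ∧ ξ < v.len ∧ v.len < w.len) :
    Splits F T w := by
  have hl : Order.IsSuccLimit w.len := by
    refine Ordinal.isSuccLimit_iff.2 ⟨h0, Order.isSuccPrelimit_of_succ_lt fun a ha => ?_⟩
    obtain ⟨v, -, -, h1, h2⟩ := h a ha
    exact (Order.succ_le_of_lt h1).trans_lt h2
  refine hT.limit_splits w hl fun ξ hξ => ?_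
  obtain ⟨v, hv, hvw, h1, h2⟩ := h ξ hξ
  exact ⟨v.len, h1.le, h2, by rwa [Node.restrict_of_le hvw]⟩

theorem IsMillerTree.exists_succ [F.NeBot] (hT : IsMillerTree F T) {u : Node κ} (hu : u ∈ T) :
    ∃ v ∈ T, u ≤ v ∧ v.len = Order.succ u.len := by
  have : (succSet T u).Nonempty := by
    by_cases h : Splits F T u
    · exact F.nonempty_of_mem h.2
    · exact (hT.unique_succ u hu h).exists
  obtain ⟨β, v, hv, hs⟩ := this
  exact ⟨v, hv, le_of_isSnoc hs, hs.1⟩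

/-- Zorn's lemma among nodes of length at most `α`; this bound makes unions of chains nodes again. A
maximal node shorter than `α` would still have a successor. -/
theorem IsMillerTree.exists_extension [F.NeBot] (hT : IsMillerTree F T) {u : Node κ} (hu : u ∈ T)
    {α : Ordinal.{u}} (hα : α < κ.ord) : ∃ v ∈ T, u ≤ v ∧ α ≤ v.len := by
  rcases le_total α u.len with h | h
  · exact ⟨u, hu, le_rfl, h⟩
  obtain ⟨m, hum, hm⟩ := zorn_le_nonempty₀ {v | v ∈ T ∧ v.len ≤ α} (fun c hcs hc y _ => by
    obtain ⟨w, hwα, hw, hw'⟩ := Node.exists_union c hc hα fun v hv => (hcs hv).2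
    refine ⟨w, ⟨hT.mem_of_approx fun ξ hξ => ?_, hwα⟩, hw⟩
    obtain ⟨v, hv, h⟩ := hw' ξ hξ
    exact ⟨v, (hcs hv).1, hw v hv, h⟩) u ⟨hu, h⟩
  refine ⟨m, hm.prop.1, hum, not_lt.1 fun hlt => ?_⟩
  obtain ⟨v, hv, hmv, hvl⟩ := hT.exists_succ hm.prop.1
  have := Node.len_le (hm.le_of_ge ⟨hv, hvl ▸ Order.succ_le_of_lt hlt⟩ hmv)
  exact (Order.lt_succ m.len).not_ge (hvl ▸ this)

theorem IsMillerTree.exists_splits_extension [F.NeBot] (hT : IsMillerTree F T) {u : Node κ}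
    (hu : u ∈ T) {α : Ordinal.{u}} (hα : α < κ.ord) :
    ∃ v, Splits F T v ∧ u ≤ v ∧ α ≤ v.len := by
  obtain ⟨v, hv, huv, h⟩ := hT.exists_extension hu hα
  obtain ⟨t, hvt, ht⟩ := hT.exists_splits v hv
  exact ⟨t, ht, huv.trans hvt, h.trans (Node.len_le hvt)⟩

/-- If Miller forcing with a nonprincipal `κ`-complete filter has a condition, then the filter
contains all final segments of `κ`. -/
theorem IsMillerTree.Ioi_mem [F.NeBot] (hκ : κ.IsInaccessible) (hT : IsMillerTree F T)
    (hF : ∀ Y : Set (Below κ), F ≠ Filter.principal Y)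
    [CardinalInterFilter F (Cardinal.lift.{u + 1} κ)] (α : Below κ) : Set.Ioi α ∈ F := by
  have hcard := mk_Iic_lt_lift hκ
  have key : ∀ y : Below κ, ∃ A ∈ F, y ∉ A := by
    intro y
    by_contra! hy
    obtain ⟨u, hu⟩ := hT.nonempty
    obtain ⟨t, -, ht⟩ := hT.exists_splits u hu
    -- Otherwise this set in `F` is bounded by `y`. Intersecting it with sets in `F` that omit each
    -- removable `z ≤ y` leaves only points common to all members, so `F` would be principal.
    have hβ : ∃ β ∈ succSet T t, y < β := by
      by_contra! hβ
      refine hF {z | ∀ A ∈ F, z ∈ A} (le_antisymm ?_ fun A hA z hz => hz A hA)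
      rw [Filter.le_principal_iff]
      have hA : ∀ z : Below κ, ∃ A ∈ F, z ∈ A → ∀ A ∈ F, z ∈ A := by
        intro z
        by_cases h : ∀ A ∈ F, z ∈ A
        · exact ⟨Set.univ, Filter.univ_mem, fun _ => h⟩
        · push Not at h
          obtain ⟨A, hA, hz⟩ := h
          exact ⟨A, hA, fun h => absurd h hz⟩
      choose A hAF hA using hA
      have := (Filter.cardinal_bInter_mem (l := F) (hcard y) (s := fun z _ => A z)).2
        fun z _ => hAF z
      filter_upwards [ht.2, this] with z hz hz'
      exact hA z (Set.mem_iInter₂.1 hz' z (hβ z hz))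
    obtain ⟨β, ⟨v, hv, hs⟩, hyβ⟩ := hβ
    obtain ⟨t', hvt', ht'⟩ := hT.exists_splits v hv
    obtain ⟨w, hw, hs'⟩ := hy _ ht'.2
    have hlt : t.len < t'.len := (Order.lt_succ _).trans_le (hs.1 ▸ Node.len_le hvt')
    have h1 := hT.strictlyIncreasing w hw t.len t'.len hlt (hs'.1 ▸ Order.lt_succ _)
    rw [hs'.2.2, ← hs'.2.1.2 _ hlt, ← hvt'.2 _ (hs.1 ▸ Order.lt_succ _), hs.2.2] at h1
    exact lt_asymm h1 hyβ
  choose A hA hyA using key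
  have := (Filter.cardinal_bInter_mem (l := F) (hcard α) (s := fun z _ => A z)).2 fun z _ => hA z
  filter_upwards [this] with z hz
  exact lt_of_not_ge fun hzα : z ≤ α => hyA z (Set.mem_iInter₂.1 hz z hzα)

/-- The subtree of all nodes of `T` comparable with `u`. -/
def subtree (T : Set (Node κ)) (u : Node κ) : Set (Node κ) :=
  {v | v ∈ T ∧ ∀ ξ < v.len, ξ < u.len → v.val ξ = u.val ξ}

theorem subtree_subset {u : Node κ} : subtree T u ⊆ T := fun _ h => h.1

theorem mem_subtree_of_le {u v : Node κ} (hv : v ∈ T) (h : u ≤ v) : v ∈ subtree T u :=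
  ⟨hv, fun _ _ hξ => (Node.val_eq h hξ).symm⟩

theorem mem_subtree_of_ge {u v : Node κ} (hv : v ∈ T) (h : v ≤ u) : v ∈ subtree T u :=
  ⟨hv, fun _ hξ _ => Node.val_eq h hξ⟩

theorem le_of_mem_subtree {u v : Node κ} (hv : v ∈ subtree T u) (h : u.len ≤ v.len) : u ≤ v :=
  ⟨h, fun ξ hξ => (hv.2 ξ (hξ.trans_le h) hξ).symm⟩

theorem le_of_mem_subtree' {u v : Node κ} (hv : v ∈ subtree T u) (h : v.len ≤ u.len) : v ≤ u :=
  ⟨h, fun ξ hξ => hv.2 ξ hξ (hξ.trans_le h)⟩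

theorem succSet_subtree {u v : Node κ} (h : u ≤ v) : succSet (subtree T u) v = succSet T v := by
  ext β
  constructor
  · rintro ⟨w, hw, hs⟩
    exact ⟨w, hw.1, hs⟩
  · rintro ⟨w, hw, hs⟩
    exact ⟨w, mem_subtree_of_le hw (h.trans (le_of_isSnoc hs)), hs⟩

theorem val_eq_of_mem_succSet_subtree {u v : Node κ} (h : v.len < u.len) {β : Below κ}
    (hβ : β ∈ succSet (subtree T u) v) : (β : Ordinal) = u.val v.len := by
  obtain ⟨w, hw, hs⟩ := hβ
  rw [← hs.2.2]
  exact hw.2 _ (hs.1 ▸ Order.lt_succ _) h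

theorem Splits.mono (hST : S ⊆ T) {u : Node κ} (h : Splits F S u) : Splits F T u :=
  ⟨hST h.1, Filter.mem_of_superset h.2 fun _ ⟨v, hv, hs⟩ => ⟨v, hST hv, hs⟩⟩

/-- Nothing changes from `u` upwards, while a node strictly below `u` keeps only the successor along
`u`. Final segments in `F` prevent such a node from splitting, so a limit of splitting nodes must
extend `u`. -/
theorem IsMillerTree.subtree [F.NeBot] (hT : IsMillerTree F T) (hF : ∀ α, Set.Ioi α ∈ F)
    {u : Node κ} (hu : u ∈ T) : IsMillerTree F (subtree T u) where
  nonempty := ⟨u, mem_subtree_of_le hu le_rfl⟩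
  isTree v w hw h := ⟨hT.isTree v w hw.1 h, fun ξ hξ hξu => by
    rw [← hw.2 ξ (hξ.trans_le h.1) hξu]; exact h.2 ξ hξ⟩
  strictlyIncreasing v hv := hT.strictlyIncreasing v hv.1
  exists_splits v hv := by
    obtain ⟨w, hw, hvw, huw⟩ : ∃ w ∈ T, v ≤ w ∧ u ≤ w := by
      rcases le_total u.len v.len with h | h
      · exact ⟨v, hv.1, le_rfl, le_of_mem_subtree hv h⟩
      · exact ⟨u, hu, le_of_mem_subtree' hv h, le_rfl⟩
    obtain ⟨t, hwt, ht⟩ := hT.exists_splits w hw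
    refine ⟨t, hvw.trans hwt, mem_subtree_of_le ht.1 (huw.trans hwt), ?_⟩
    rw [succSet_subtree (huw.trans hwt)]
    exact ht.2
  unique_succ v hv hns := by
    rcases le_or_gt u.len v.len with h | h
    · have huv := le_of_mem_subtree hv h
      rw [succSet_subtree huv]
      refine hT.unique_succ v hv.1 fun hs => hns ⟨hv, ?_⟩
      rw [succSet_subtree huv]
      exact hs.2
    · have hvu := le_of_mem_subtree' hv h.le
      have hl := Order.succ_le_of_lt h
      refine ⟨⟨u.val v.len, u.val_lt _ h⟩, ⟨u.restrict (Order.succ v.len),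
        mem_subtree_of_ge (hT.mem_of_le hu (Node.restrict_le _ _)) (Node.restrict_le _ _),
        Node.restrict_len hl, ?_, Node.restrict_val_of_lt _ (Order.lt_succ _)⟩,
        fun β hβ => Subtype.ext (val_eq_of_mem_succSet_subtree h hβ)⟩
      exact Node.le_of_le_of_le hvu (Node.restrict_le _ _)
        ((Node.restrict_len hl).symm ▸ Order.le_succ _)
  limit_mem v hl hv := ⟨hT.limit_mem v hl fun β hβ => (hv β hβ).1, fun ξ hξ hξu => by
    have hξ' := hl.succ_lt hξ
    rw [← (hv _ hξ').2 ξ (by rw [Node.restrict_len hξ'.le]; exact Order.lt_succ _) hξu]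
    exact (Node.restrict_val_of_lt _ (Order.lt_succ _)).symm⟩
  limit_splits v hl hv := by
    have hs : Splits F T v := hT.limit_splits v hl fun ξ hξ =>
      let ⟨β, h1, h2, h3⟩ := hv ξ hξ
      ⟨β, h1, h2, h3.mono subtree_subset⟩
    have huv : u.len ≤ v.len := by
      by_contra! h
      obtain ⟨β, -, h2, h3⟩ := hv 0 hl.bot_lt
      have hβ := Node.restrict_len h2.le
      have hlt : (v.restrict β).len < u.len := hβ.trans_lt (h2.trans h)
      have := F.nonempty_of_mem (Filter.inter_mem h3.2 (hF ⟨_, u.val_lt _ hlt⟩))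
      obtain ⟨γ, h4, h5⟩ := this
      have h6 : u.val (v.restrict β).len < γ := h5
      exact h6.ne' (val_eq_of_mem_succSet_subtree hlt h4)
    have hle : u ≤ v := ⟨huv, fun ξ hξ => by
      obtain ⟨β, h1, h2, h3⟩ := hv _ (hl.succ_lt (hξ.trans_le huv))
      rw [← h3.1.2 ξ (by rw [Node.restrict_len h2.le]; exact (Order.lt_succ _).trans_le h1) hξ]
      exact Node.restrict_val_of_lt _ ((Order.lt_succ _).trans_le h1)⟩
    refine ⟨mem_subtree_of_le hs.1 hle, ?_⟩
    rw [succSet_subtree hle]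
    exact hs.2

/-- A splitting node can be extended so as to dominate a given splitting node of another tree. -/
theorem IsMillerTree.exists_dominating [F.NeBot] (hκ : κ.IsInaccessible) (hT : IsMillerTree F T)
    (hS : IsMillerTree F S) (hF : ∀ α, Set.Ioi α ∈ F) {a b : Node κ} (ha : Splits F T a)
    (hb : Splits F S b) :
    ∃ a', Splits F T a' ∧ a ≤ a' ∧ a.len < a'.len ∧ b.len < a'.len ∧
      ∀ ξ, a.len ≤ ξ → ξ < b.len → b.val ξ < a'.val ξ := by
  -- A successor value `η` of `b` bounds every value of `b`. If the next entry after `a` exceeds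
  -- `η`, strict increase keeps all later entries above it.
  obtain ⟨η, w, hw, hws⟩ := F.nonempty_of_mem hb.2
  obtain ⟨β, ⟨v, hv, hvs⟩, hβ⟩ := F.nonempty_of_mem (Filter.inter_mem ha.2 (hF η))
  have hlim := Cardinal.isSuccLimit_ord hκ.aleph0_lt.le
  obtain ⟨a', ha', hva', hl⟩ := hT.exists_splits_extension hv (hlim.succ_lt b.len_lt)
  have hlt : a.len < a'.len := (Order.lt_succ _).trans_le (hvs.1 ▸ Node.len_le hva')
  refine ⟨a', ha', (le_of_isSnoc hvs).trans hva', hlt, (Order.lt_succ _).trans_le hl, ?_⟩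
  intro ξ h1 h2
  have h3 : b.val ξ < η := by
    have := hS.strictlyIncreasing w hw ξ b.len h2 (hws.1 ▸ Order.lt_succ _)
    rwa [hws.2.2, ← hws.2.1.2 _ h2] at this
  have h4 : a'.val a.len = β := by
    rw [← hvs.2.2]; exact (Node.val_eq hva' (hvs.1 ▸ Order.lt_succ _)).symm
  have h5 : a'.val a.len ≤ a'.val ξ := by
    rcases h1.eq_or_lt with rfl | h1
    · exact le_rfl
    · exact (hT.strictlyIncreasing a' ha'.1 _ _ h1
        (h2.trans ((Order.lt_succ _).trans_le hl))).le
  exact (h3.trans (Subtype.coe_lt_coe.2 hβ)).trans_le (h4 ▸ h5)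

end Tree

/-! ### Oscillation of functions on the ordinals -/

/-- `α` is an oscillation point of `f` and `g`. -/
def Osc (f g : Ordinal.{u} → Ordinal.{u}) (α : Ordinal.{u}) : Prop :=
  ∃ γ < α, (g α < f α ∧ ∀ β, γ ≤ β → β < α → f β < g β) ∨
    (f α < g α ∧ ∀ β, γ ≤ β → β < α → g β < f β)

/-- `δ` is a limit of oscillation points of `f` and `g`. -/
def OscLim (f g : Ordinal.{u} → Ordinal.{u}) (δ : Ordinal.{u}) : Prop :=
  0 < δ ∧ ∀ ξ < δ, ∃ α, ξ < α ∧ α < δ ∧ Osc f g α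

section Osc

variable {f g f' g' : Ordinal.{u} → Ordinal.{u}}

theorem osc_comm {α : Ordinal.{u}} : Osc f g α ↔ Osc g f α := by
  simp only [Osc, or_comm]

theorem oscLim_comm {α : Ordinal.{u}} : OscLim f g α ↔ OscLim g f α := by
  simp only [OscLim, osc_comm (f := f)]

theorem Osc.congr {α l : Ordinal.{u}} (hf : ∀ ξ < l, f ξ = f' ξ) (hg : ∀ ξ < l, g ξ = g' ξ)
    (hα : α < l) (h : Osc f g α) : Osc f' g' α := by
  obtain ⟨γ, hγ, h⟩ := h
  refine ⟨γ, hγ, h.imp (And.imp (by rw [hf α hα, hg α hα]; exact id) fun h β h1 h2 => ?_)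
    (And.imp (by rw [hf α hα, hg α hα]; exact id) fun h β h1 h2 => ?_)⟩
  all_goals
    rw [← hf β (h2.trans hα), ← hg β (h2.trans hα)]
    exact h β h1 h2

theorem OscLim.congr {δ l : Ordinal.{u}} (hf : ∀ ξ < l, f ξ = f' ξ) (hg : ∀ ξ < l, g ξ = g' ξ)
    (hδ : δ ≤ l) (h : OscLim f g δ) : OscLim f' g' δ :=
  ⟨h.1, fun ξ hξ =>
    let ⟨α, h1, h2, h3⟩ := h.2 ξ hξ
    ⟨α, h1, h2, h3.congr hf hg (h2.trans_le hδ)⟩⟩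

theorem OscLim.of_limit {δ : Ordinal.{u}} (h0 : 0 < δ)
    (h : ∀ ξ < δ, ∃ α, ξ < α ∧ α ≤ δ ∧ OscLim f g α) : OscLim f g δ :=
  ⟨h0, fun ξ hξ =>
    let ⟨_, h1, h2, h3⟩ := h ξ hξ
    let ⟨β, h4, h5, h6⟩ := h3.2 ξ h1
    ⟨β, h4, h5.trans_le h2, h6⟩⟩

/-- An oscillation point strictly between `x` and `η` needs the opposite comparison either at itself
or just before itself, and both places lie in `[x, y)`. -/
theorem not_oscLim_of_lt {x y η : Ordinal.{u}} (h : ∀ β, x ≤ β → β < y → f β < g β) (hx : x < η)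
    (hy : η ≤ y) : ¬ OscLim f g η := by
  rintro ⟨-, hη⟩
  obtain ⟨α, h1, h2, γ, hγ, h3 | h3⟩ := hη x hx
  · exact lt_asymm h3.1 (h α h1.le (h2.trans_le hy))
  · have hm : max x γ < α := max_lt h1 hγ
    exact lt_asymm (h3.2 _ (le_max_right _ _) hm)
      (h _ (le_max_left _ _) ((hm.trans h2).trans_le hy))

theorem not_oscLim_of_gt {x y η : Ordinal.{u}} (h : ∀ β, x ≤ β → β < y → g β < f β) (hx : x < η)
    (hy : η ≤ y) : ¬ OscLim f g η :=
  fun h' => not_oscLim_of_lt h hx hy (oscLim_comm.1 h')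

end Osc

/-! ### Pairs of splitting nodes -/

section Pair

variable {F : Filter (Below κ)} {T S : Set (Node κ)}

/-- A state of the construction of two branches which alternately dominate each other. -/
structure Interleaved (F : Filter (Below κ)) (T S : Set (Node κ)) where
  fst : Node κ
  snd : Node κ
  fst_splits : Splits F T fst
  snd_splits : Splits F S snd
  len_lt : fst.len < snd.len

/-- Each node overtakes the other once. The two comparison intervals are adjacent, so iteration
leaves no gap in which the comparison is unknown. -/
theorem Interleaved.exists_next [F.NeBot] (hκ : κ.IsInaccessible) (hT : IsMillerTree F T)
    (hS : IsMillerTree F S) (hF : ∀ α, Set.Ioi α ∈ F) (s : Interleaved F T S) :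
    ∃ t : Interleaved F T S, s.fst ≤ t.fst ∧ s.snd ≤ t.snd ∧ s.snd.len < t.fst.len ∧
      (∀ ξ, s.fst.len ≤ ξ → ξ < s.snd.len → s.snd.val ξ < t.fst.val ξ) ∧
      ∀ ξ, s.snd.len ≤ ξ → ξ < t.fst.len → t.fst.val ξ < t.snd.val ξ := by
  obtain ⟨a, ha, h1, -, h2, h3⟩ := hT.exists_dominating hκ hS hF s.fst_splits s.snd_splits
  obtain ⟨b, hb, h4, -, h5, h6⟩ := hS.exists_dominating hκ hT hF s.snd_splits ha
  exact ⟨⟨a, b, ha, hb, h5⟩, h1, h4, h2, h3, h6⟩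

/-- Two splitting nodes of different lengths extend to splitting nodes whose length is the first
limit of oscillation points above the smaller length. -/
theorem Interleaved.exists_next_oscLim [F.NeBot] (hκ : κ.IsInaccessible) (hT : IsMillerTree F T)
    (hS : IsMillerTree F S) (hF : ∀ α, Set.Ioi α ∈ F) (s : Interleaved F T S) :
    ∃ a b : Node κ, Splits F T a ∧ Splits F S b ∧ s.fst ≤ a ∧ s.snd ≤ b ∧ a.len = b.len ∧
      s.snd.len < a.len ∧ OscLim a.val b.val a.len ∧
      ∀ η, s.fst.len < η → η < a.len → ¬ OscLim a.val b.val η := by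
  choose next hfst hsnd hlen hlt hgt using Interleaved.exists_next hκ hT hS hF
  let x : ℕ → Interleaved F T S := fun n => next^[n] s
  have hx : ∀ n, x (n + 1) = next (x n) := fun n => Function.iterate_succ_apply' next n s
  have hm1 : Monotone fun n => (x n).fst := monotone_nat_of_le_succ fun n => by
    simp only [hx]; exact hfst _
  have hm2 : Monotone fun n => (x n).snd := monotone_nat_of_le_succ fun n => by
    simp only [hx]; exact hsnd _
  have hl : ∀ n, (x n).snd.len < (x (n + 1)).fst.len := fun n => by rw [hx]; exact hlen _
  -- Countably many lengths are bounded because `κ` is regular and uncountable.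
  obtain ⟨μ, hμ, hb⟩ := exists_bound_of_mk_lt hκ (fun n => (x n).snd.len)
    (by simpa using hκ.aleph0_lt) fun n => (x n).snd.len_lt
  obtain ⟨a, -, ha, ha'⟩ := Node.exists_union (Set.range fun n => (x n).fst)
    (hm1.isChain_range) hμ
    (by rintro _ ⟨n, rfl⟩; exact (x n).len_lt.le.trans (hb n))
  obtain ⟨b, -, hb, hb'⟩ := Node.exists_union (Set.range fun n => (x n).snd)
    (hm2.isChain_range) hμ (by rintro _ ⟨n, rfl⟩; exact hb n)
  replace ha : ∀ n, (x n).fst ≤ a := fun n => ha _ ⟨n, rfl⟩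
  replace hb : ∀ n, (x n).snd ≤ b := fun n => hb _ ⟨n, rfl⟩
  replace ha' : ∀ ξ < a.len, ∃ n, ξ < (x n).fst.len := fun ξ hξ => by
    obtain ⟨_, ⟨n, rfl⟩, h⟩ := ha' ξ hξ
    exact ⟨n, h⟩
  replace hb' : ∀ ξ < b.len, ∃ n, ξ < (x n).snd.len := fun ξ hξ => by
    obtain ⟨_, ⟨n, rfl⟩, h⟩ := hb' ξ hξ
    exact ⟨n, h⟩
  have hla : ∀ n, (x n).fst.len < a.len := fun n =>
    ((x n).len_lt.trans (hl n)).trans_le (Node.len_le (ha _))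
  have hlb : ∀ n, (x n).snd.len < b.len := fun n =>
    ((hl n).trans (x (n + 1)).len_lt).trans_le (Node.len_le (hb _))
  have hab : a.len = b.len := by
    apply le_antisymm
    · refine le_of_forall_lt fun ξ hξ => ?_
      obtain ⟨n, h⟩ := ha' ξ hξ
      exact h.trans ((x n).len_lt.trans (hlb n))
    · refine le_of_forall_lt fun ξ hξ => ?_
      obtain ⟨n, h⟩ := hb' ξ hξ
      exact h.trans ((hl n).trans (hla _))
  have h1 : ∀ n ξ, (x n).fst.len ≤ ξ → ξ < (x n).snd.len → b.val ξ < a.val ξ := by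
    intro n ξ h h'
    rw [← Node.val_eq (hb n) h', ← Node.val_eq (ha (n + 1)) (h'.trans (hl n)), hx]
    exact hlt _ ξ h h'
  have h2 : ∀ n ξ, (x n).snd.len ≤ ξ → ξ < (x (n + 1)).fst.len → a.val ξ < b.val ξ := by
    intro n ξ h h'
    rw [← Node.val_eq (ha (n + 1)) h', ← Node.val_eq (hb (n + 1)) (h'.trans (x (n + 1)).len_lt), hx]
    rw [hx] at h'
    exact hgt _ ξ h h'
  have h0a : 0 < a.len := zero_le.trans_lt (hla 0)
  refine ⟨a, b, hT.splits_of_approx h0a.ne' fun ξ hξ => ?_,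
    hS.splits_of_approx (hab ▸ h0a.ne') fun ξ hξ => ?_, ha 0, hb 0, hab, hab ▸ hlb 0,
    ⟨h0a, fun ξ hξ => ?_⟩, fun η hη hη' => ?_⟩
  · obtain ⟨n, h⟩ := ha' ξ hξ
    exact ⟨_, (x n).fst_splits, ha n, h, hla n⟩
  · obtain ⟨n, h⟩ := hb' ξ hξ
    exact ⟨_, (x n).snd_splits, hb n, h, hlb n⟩
  -- The oscillation point is the length of the second node at stage `n`: the first function is
  -- larger on the interval ending there, and the second is larger at the point itself.
  · obtain ⟨n, h⟩ := ha' ξ hξ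
    exact ⟨_, h.trans (x n).len_lt, hab ▸ hlb n, (x n).fst.len, (x n).len_lt,
      Or.inr ⟨h2 n _ le_rfl (hl n), fun β h3 h4 => h1 n β h3 h4⟩⟩
  · classical
    -- The least such stage is not `0`, so it traps `η` in one of the two half-open intervals
    -- between consecutive stages, where the comparison is constant.
    have hex : ∃ n, η ≤ (x n).fst.len := (ha' η hη').imp fun _ h => h.le
    have hspec := Nat.find_spec hex
    obtain ⟨n, hn⟩ : ∃ n, (x n).fst.len < η ∧ η ≤ (x (n + 1)).fst.len := by
      rcases hfind : Nat.find hex with _ | n <;> rw [hfind] at hspec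
      · exact absurd hspec (not_le.2 hη)
      · exact ⟨n, not_le.1 (Nat.find_min hex (hfind ▸ n.lt_succ_self)), hspec⟩
    rcases le_or_gt η (x n).snd.len with h | h
    · exact not_oscLim_of_gt (h1 n) hn.1 h
    · exact not_oscLim_of_lt (h2 n) h hn.2

/-- A pair of splitting nodes of the same length extends to a pair whose length is the next limit
of oscillation points, with a prescribed comparison at the old length. -/
theorem exists_next_oscLim_of_lt [F.NeBot] (hκ : κ.IsInaccessible) (hT : IsMillerTree F T)
    (hS : IsMillerTree F S) (hF : ∀ α, Set.Ioi α ∈ F) {a b : Node κ} (ha : Splits F T a)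
    (hb : Splits F S b) (hab : a.len = b.len) :
    ∃ a' b' : Node κ, Splits F T a' ∧ Splits F S b' ∧ a ≤ a' ∧ b ≤ b' ∧ a'.len = b'.len ∧
      a.len < a'.len ∧ OscLim a'.val b'.val a'.len ∧
      (∀ η, a.len < η → η < a'.len → ¬ OscLim a'.val b'.val η) ∧ a'.val a.len < b'.val a.len := by
  -- Dominating `a` by its own extension serves only to lengthen it. Then `d` exceeds `c` from the
  -- old length on, which fixes the comparison there and excludes limit points up to the length of
  -- `c`.
  obtain ⟨c, hc, hac, hlc, -⟩ := hT.exists_dominating hκ hT hF ha ha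
  obtain ⟨d, hd, hbd, -, hld, hcd⟩ := hS.exists_dominating hκ hT hF hb hc
  obtain ⟨a', b', ha', hb', hca, hdb, hl, hlt, hlim, hn⟩ :=
    Interleaved.exists_next_oscLim hκ hT hS hF ⟨c, d, hc, hd, hld⟩
  have hval : ∀ β, a.len ≤ β → β < c.len → a'.val β < b'.val β := fun β h1 h2 => by
    rw [← Node.val_eq hca h2, ← Node.val_eq hdb (h2.trans hld)]
    exact hcd β (hab ▸ h1) h2
  refine ⟨a', b', ha', hb', hac.trans hca, hbd.trans hdb, hl, ?_, hlim, fun η h1 h2 => ?_,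
    hval _ le_rfl hlc⟩
  · exact (hlc.trans hld).trans hlt
  · rcases le_or_gt η c.len with h | h
    · exact not_oscLim_of_lt hval h1 h
    · exact hn η h h2

/-- Exchanging the two trees yields the other comparison, since oscillation is symmetric. -/
theorem exists_next_oscLim [F.NeBot] (hκ : κ.IsInaccessible) (hT : IsMillerTree F T)
    (hS : IsMillerTree F S) (hF : ∀ α, Set.Ioi α ∈ F) {a b : Node κ} (ha : Splits F T a)
    (hb : Splits F S b) (hab : a.len = b.len) (s : Prop) :
    ∃ a' b' : Node κ, Splits F T a' ∧ Splits F S b' ∧ a ≤ a' ∧ b ≤ b' ∧ a'.len = b'.len ∧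
      a.len < a'.len ∧ OscLim a'.val b'.val a'.len ∧
      (∀ η, a.len < η → η < a'.len → ¬ OscLim a'.val b'.val η) ∧
      (b'.val a.len < a'.val a.len ↔ s) := by
  by_cases hs : s
  · obtain ⟨b', a', h1, h2, h3, h4, h5, h6, h7, h8, h9⟩ :=
      exists_next_oscLim_of_lt hκ hS hT hF hb ha hab.symm
    refine ⟨a', b', h2, h1, h4, h3, h5.symm, hab ▸ h5 ▸ h6, oscLim_comm.1 (h5 ▸ h7),
      fun η h h' => mt oscLim_comm.1 (h8 η (hab ▸ h) (h5 ▸ h')), iff_of_true (hab ▸ h9) hs⟩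
  · obtain ⟨a', b', h1, h2, h3, h4, h5, h6, h7, h8, h9⟩ :=
      exists_next_oscLim_of_lt hκ hT hS hF ha hb hab
    exact ⟨a', b', h1, h2, h3, h4, h5, h6, h7, h8, iff_of_false h9.le.not_gt hs⟩

end Pair

/-! ### The enumeration of the limits of oscillation points -/

section Enum

/-- The limits of oscillation points of a pair of nodes of the same length, together with a final
segment of the ordinals. -/
def limSet (p : Node κ × Node κ) : Set Ordinal.{u} :=
  {δ | OscLim p.1.val p.2.val δ ∨ p.1.len ≤ δ}

theorem not_bddAbove_limSet (p : Node κ × Node κ) : ¬ BddAbove (limSet p) := by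
  rintro ⟨b, hb⟩
  exact (Order.lt_succ b).not_ge
    ((Order.succ_le_succ (le_max_left b p.1.len)).trans
      (hb (Or.inr ((le_max_right b _).trans (Order.le_succ _)))))

/-- The increasing enumeration of `limSet p`. -/
noncomputable def limEnum (p : Node κ × Node κ) : Ordinal.{u} → Ordinal.{u} := enumOrd (limSet p)

theorem limEnum_strictMono (p : Node κ × Node κ) : StrictMono (limEnum p) :=
  enumOrd_strictMono (not_bddAbove_limSet p)

theorem oscLim_limEnum {p : Node κ × Node κ} {α : Ordinal.{u}} (h : limEnum p α < p.1.len) :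
    OscLim p.1.val p.2.val (limEnum p α) :=
  (enumOrd_mem (not_bddAbove_limSet p) α).resolve_right h.not_ge

theorem exists_limEnum_eq {p : Node κ × Node κ} {δ : Ordinal.{u}} (h : δ ∈ limSet p) :
    ∃ α, limEnum p α = δ := enumOrd_surjective (not_bddAbove_limSet p) h

theorem limEnum_isNormal (p : Node κ × Node κ) : Order.IsNormal (limEnum p) := by
  refine isNormal_enumOrd (fun t ht hne hbd => ?_) (not_bddAbove_limSet p)
  rcases le_or_gt p.1.len (sSup t) with h | h
  · exact Or.inr h
  refine Or.inl ?_
  have hlim : ∀ x ∈ t, OscLim p.1.val p.2.val x := fun x hx =>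
    (ht hx).resolve_right ((le_csSup hbd hx).trans_lt h).not_ge
  obtain ⟨x, hx⟩ := hne
  refine OscLim.of_limit ((hlim x hx).1.trans_le (le_csSup hbd hx)) fun ξ hξ => ?_
  obtain ⟨y, hy, hξy⟩ := exists_lt_of_lt_csSup ⟨x, hx⟩ hξ
  exact ⟨y, hξy, le_csSup hbd hy, hlim y hy⟩

/-- Each value of the enumeration is the least element above the earlier values, so only the part of
the sets up to that value matters. -/
theorem _root_.Ordinal.enumOrd_congr {s t : Set Ordinal.{u}} (hs : ¬ BddAbove s) (ht : ¬ BddAbove t)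
    (α : Ordinal.{u}) (h : ∀ x ≤ enumOrd s α, x ∈ s ↔ x ∈ t) : enumOrd t α = enumOrd s α := by
  induction α using WellFoundedLT.induction with
  | ind α ih =>
    have ih' : ∀ β < α, enumOrd t β = enumOrd s β := fun β hβ =>
      ih β hβ fun x hx => h x (hx.trans ((enumOrd_strictMono hs hβ).le))
    have hle : enumOrd t α ≤ enumOrd s α :=
      enumOrd_le_of_forall_lt ((h _ le_rfl).1 (enumOrd_mem hs α)) fun β hβ =>
        ih' β hβ ▸ enumOrd_strictMono hs hβ
    exact hle.antisymm (enumOrd_le_of_forall_lt ((h _ hle).2 (enumOrd_mem ht α)) fun β hβ =>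
      ih' β hβ ▸ enumOrd_strictMono ht hβ)

theorem mem_limSet_iff_of_lt {p q : Node κ × Node κ} (hp : p.1.len = p.2.len) (h : p ≤ q)
    {x : Ordinal.{u}} (hx : x < p.1.len) : x ∈ limSet p ↔ x ∈ limSet q := by
  have h1 : ∀ ξ < p.1.len, p.1.val ξ = q.1.val ξ := fun ξ hξ => Node.val_eq h.1 hξ
  have h2 : ∀ ξ < p.1.len, p.2.val ξ = q.2.val ξ := fun ξ hξ => Node.val_eq h.2 (hp ▸ hξ)
  refine ⟨fun h' => Or.inl ((h'.resolve_right hx.not_ge).congr h1 h2 hx.le), fun h' =>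
    Or.inl ((h'.resolve_right (hx.trans_le (Node.len_le h.1)).not_ge).congr
      (fun ξ hξ => (h1 ξ hξ).symm) (fun ξ hξ => (h2 ξ hξ).symm) hx.le)⟩

theorem limEnum_eq_of_lt {p q : Node κ × Node κ} (hp : p.1.len = p.2.len) (h : p ≤ q)
    {α : Ordinal.{u}} (hα : limEnum p α < p.1.len) : limEnum q α = limEnum p α :=
  enumOrd_congr (not_bddAbove_limSet p) (not_bddAbove_limSet q) α fun _ hx =>
    mem_limSet_iff_of_lt hp h (hx.trans_lt hα)

/-- Here the bound is known for the longer pair, as happens when values are traced back from a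
union. -/
theorem limEnum_eq_of_lt' {p q : Node κ × Node κ} (hp : p.1.len = p.2.len) (h : p ≤ q)
    {α : Ordinal.{u}} (hα : limEnum q α < p.1.len) : limEnum q α = limEnum p α :=
  (enumOrd_congr (not_bddAbove_limSet q) (not_bddAbove_limSet p) α fun _ hx =>
    (mem_limSet_iff_of_lt hp h (hx.trans_lt hα)).symm).symm

/-- The length of `p` belongs to `limSet p` merely through the artificial tail. Being a true limit
of oscillation points, it survives in `limSet q`. -/
theorem limEnum_eq_len {p q : Node κ × Node κ} (hp : p.1.len = p.2.len) (h : p ≤ q)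
    (hlim : OscLim p.1.val p.2.val p.1.len) {α : Ordinal.{u}} (hα : limEnum p α = p.1.len) :
    limEnum q α = p.1.len := by
  rw [← hα]
  refine enumOrd_congr (not_bddAbove_limSet p) (not_bddAbove_limSet q) α fun x hx => ?_
  change x ≤ limEnum p α at hx
  rw [hα] at hx
  rcases hx.lt_or_eq with hx | rfl
  · exact mem_limSet_iff_of_lt hp h hx
  · exact iff_of_true (Or.inr le_rfl) (Or.inl (hlim.congr (fun ξ hξ => Node.val_eq h.1 hξ)
      (fun ξ hξ => Node.val_eq h.2 (hp ▸ hξ)) le_rfl))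

end Enum

/-! ### Good pairs and prescribed values of the oscillation function -/

section Good

variable {F : Filter (Below κ)} {T S : Set (Node κ)}

/-- A pair of splitting nodes whose common length is a limit of oscillation points. -/
structure GoodPair (F : Filter (Below κ)) (T S : Set (Node κ)) (p : Node κ × Node κ) : Prop where
  fst_splits : Splits F T p.1
  snd_splits : Splits F S p.2
  len_eq : p.1.len = p.2.len
  oscLim : OscLim p.1.val p.2.val p.1.len

/-- The value at `α` of the oscillation function is `1`. -/
def HighAt (p : Node κ × Node κ) (α : Ordinal.{u}) : Prop :=
  p.2.val (limEnum p α) < p.1.val (limEnum p α)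

theorem highAt_iff_of_lt {p q : Node κ × Node κ} (hp : p.1.len = p.2.len) (h : p ≤ q)
    {α : Ordinal.{u}} (hα : limEnum p α < p.1.len) : HighAt q α ↔ HighAt p α := by
  rw [HighAt, HighAt, limEnum_eq_of_lt hp h hα, Node.val_eq h.1 hα, Node.val_eq h.2 (hp ▸ hα)]

theorem exists_goodPair [F.NeBot] (hκ : κ.IsInaccessible) (hT : IsMillerTree F T)
    (hS : IsMillerTree F S) (hF : ∀ α, Set.Ioi α ∈ F) {a b : Node κ} (ha : a ∈ T) (hb : b ∈ S)
    {ξ : Ordinal.{u}} (hξ : ξ < κ.ord) :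
    ∃ p, GoodPair F T S p ∧ a ≤ p.1 ∧ b ≤ p.2 ∧ ξ < p.1.len := by
  have hlim := Cardinal.isSuccLimit_ord hκ.aleph0_lt.le
  obtain ⟨c, hc, hac, hξc⟩ := hT.exists_splits_extension ha hξ
  obtain ⟨d, hd, hbd, hcd⟩ := hS.exists_splits_extension hb (hlim.succ_lt c.len_lt)
  have hcd' := (Order.lt_succ _).trans_le hcd
  obtain ⟨a', b', h1, h2, h3, h4, h5, h6, h7, -⟩ :=
    Interleaved.exists_next_oscLim hκ hT hS hF ⟨c, d, hc, hd, hcd'⟩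
  exact ⟨(a', b'), ⟨h1, h2, h5, h7⟩, hac.trans h3, hbd.trans h4, (hξc.trans_lt hcd').trans h6⟩

theorem GoodPair.exists_limEnum_eq {p : Node κ × Node κ} (_ : GoodPair F T S p) :
    ∃ β < κ.ord, limEnum p β = p.1.len := by
  obtain ⟨β, hβ⟩ := KappaForcing.exists_limEnum_eq (p := p) (δ := p.1.len) (Or.inr le_rfl)
  exact ⟨β, ((limEnum_strictMono p).le_apply.trans hβ.le).trans_lt p.1.len_lt, hβ⟩

/-- The free bit: both nodes split at the `β`-th limit point, so the comparison there can still be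
chosen. The absence of limit points in between makes the new index exactly the successor of `β`. -/
theorem GoodPair.exists_next [F.NeBot] (hκ : κ.IsInaccessible) (hT : IsMillerTree F T)
    (hS : IsMillerTree F S) (hF : ∀ α, Set.Ioi α ∈ F) {p : Node κ × Node κ}
    (hp : GoodPair F T S p) {β : Ordinal.{u}} (hβ : limEnum p β = p.1.len) (s : Prop) :
    ∃ q, GoodPair F T S q ∧ p ≤ q ∧ p.1.len < q.1.len ∧ limEnum q (Order.succ β) = q.1.len ∧
      (HighAt q β ↔ s) := by
  obtain ⟨a, b, h1, h2, h3, h4, h5, h6, h7, h8, h9⟩ :=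
    exists_next_oscLim hκ hT hS hF hp.fst_splits hp.snd_splits hp.len_eq s
  have hle : p ≤ (a, b) := ⟨h3, h4⟩
  have hq := limEnum_eq_len hp.len_eq hle hp.oscLim hβ
  refine ⟨(a, b), ⟨h1, h2, h5, h7⟩, hle, h6, le_antisymm ?_ ?_, ?_⟩
  · exact enumOrd_succ_le (not_bddAbove_limSet _) (Or.inr le_rfl) (hq.trans_lt h6)
  · by_contra! hlt
    exact h8 _ (hq ▸ limEnum_strictMono (a, b) (Order.lt_succ β)) hlt (oscLim_limEnum hlt)
  · rw [HighAt, hq]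
    exact h9

/-- Good pairs which realize a given part of `s` as the oscillation function. -/
structure Realizes (F : Filter (Below κ)) (T S : Set (Node κ)) (s : Ordinal.{u} → Prop)
    (β₀ β : Ordinal.{u}) (p : Node κ × Node κ) : Prop extends GoodPair F T S p where
  limEnum_eq : limEnum p β = p.1.len
  highAt_iff : ∀ ξ, β₀ ≤ ξ → ξ < β → (HighAt p ξ ↔ s ξ)

theorem GoodPair.len_lt_of_not_le
    {p q : Node κ × Node κ} (hp : GoodPair F T S p) (hq : GoodPair F T S q) (h : p ≤ q)
    (hn : ¬ q ≤ p) : p.1.len < q.1.len := by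
  by_contra! hl
  refine hn ⟨(Node.eq_of_le_of_len_le h.1 hl).ge, (Node.eq_of_le_of_len_le h.2 ?_).ge⟩
  rwa [← hp.len_eq, ← hq.len_eq]

/-- The limit stage. Without a greatest element the union works: splitting and being a limit of
oscillation points pass to limits, and each bit of the union is already settled in some member. -/
theorem exists_upperBound_of_chain (hκ : κ.IsInaccessible) (hT : IsMillerTree F T)
    (hS : IsMillerTree F S) {s : Ordinal.{u} → Prop} {β₀ β₁ : Ordinal.{u}} (hβ₁ : β₁ < κ.ord)
    (c : Set (Node κ × Node κ)) (hcs : ∀ p ∈ c, ∃ β ≤ β₁, Realizes F T S s β₀ β p)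
    (hc : IsChain (· ≤ ·) c) (hne : c.Nonempty) :
    ∃ w, (∃ β ≤ β₁, Realizes F T S s β₀ β w) ∧ ∀ p ∈ c, p ≤ w := by
  by_cases hmax : ∃ w ∈ c, ∀ p ∈ c, p ≤ w
  · obtain ⟨w, hw, h⟩ := hmax
    exact ⟨w, hcs w hw, h⟩
  push Not at hmax
  have hgt : ∀ p ∈ c, ∃ q ∈ c, p ≤ q ∧ p.1.len < q.1.len := by
    intro p hp
    obtain ⟨q, hq, hqp⟩ := hmax p hp
    have hpq := (hc.total hp hq).resolve_right hqp
    obtain ⟨_, -, h1⟩ := hcs p hp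
    obtain ⟨_, -, h2⟩ := hcs q hq
    exact ⟨q, hq, hpq, h1.toGoodPair.len_lt_of_not_le h2.toGoodPair hpq hqp⟩
  obtain ⟨μ, hμ, hb⟩ : ∃ μ < κ.ord, ∀ p ∈ c, p.1.len ≤ μ := by
    choose! idx hidx hreal using hcs
    -- In a chain the index determines the length, so there are at most as many lengths as indices
    -- up to `β₁`, fewer than `κ`.
    have hlen : ∀ p ∈ c, ∀ q ∈ c, idx p = idx q → p.1.len = q.1.len := by
      intro p hp q hq h
      rcases hc.total hp hq with h' | h'
      · have := limEnum_eq_len (hreal p hp).len_eq h' (hreal p hp).oscLim (hreal p hp).limEnum_eq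
        rw [← this, h, (hreal q hq).limEnum_eq]
      · have := limEnum_eq_len (hreal q hq).len_eq h' (hreal q hq).oscLim (hreal q hq).limEnum_eq
        rw [← this, ← h, (hreal p hp).limEnum_eq]
    classical
    obtain ⟨μ, hμ, h⟩ := exists_bound_of_mk_lt hκ
      (fun β : Set.Iic (⟨β₁, Set.mem_Iio.2 hβ₁⟩ : Below κ) =>
        if h : ∃ p ∈ c, idx p = β then h.choose.1.len else 0)
      ((Cardinal.lift_id'.{u, u + 1} _).trans_lt (mk_Iic_lt_lift hκ _)) (fun β => by
        split_ifs with h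
        · exact h.choose.1.len_lt
        · exact hβ₁.bot_lt)
    refine ⟨μ, hμ, fun p hp => ?_⟩
    have hex : ∃ q ∈ c, idx q = idx p := ⟨p, hp, rfl⟩
    refine le_trans ?_ (h ⟨⟨idx p, Set.mem_Iio.2 ((hidx p hp).trans_lt hβ₁)⟩,
      Set.mem_Iic.2 (Subtype.coe_le_coe.1 (hidx p hp))⟩)
    simp only [dif_pos hex]
    exact (hlen p hp _ hex.choose_spec.1 hex.choose_spec.2.symm).le
  have hc1 : IsChain (· ≤ ·) (Prod.fst '' c) := monotone_fst.isChain_image hc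
  have hc2 : IsChain (· ≤ ·) (Prod.snd '' c) := monotone_snd.isChain_image hc
  have hlen : ∀ p ∈ c, p.1.len = p.2.len := fun p hp =>
    let ⟨_, _, h⟩ := hcs p hp
    h.len_eq
  obtain ⟨a, -, ha, ha'⟩ := Node.exists_union _ hc1 hμ
    (by rintro _ ⟨p, hp, rfl⟩; exact hb p hp)
  obtain ⟨b, -, hb, hb'⟩ := Node.exists_union _ hc2 hμ
    (by rintro _ ⟨p, hp, rfl⟩; exact hlen p hp ▸ hb p hp)
  have hle : ∀ p ∈ c, p ≤ (a, b) := fun p hp => ⟨ha _ ⟨p, hp, rfl⟩, hb _ ⟨p, hp, rfl⟩⟩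
  have hlt : ∀ p ∈ c, p.1.len < a.len := fun p hp =>
    let ⟨q, hq, _, h⟩ := hgt p hp
    h.trans_le (Node.len_le (hle q hq).1)
  have happ : ∀ ξ < a.len, ∃ p ∈ c, ξ < p.1.len := fun ξ hξ => by
    obtain ⟨_, ⟨p, hp, rfl⟩, h⟩ := ha' ξ hξ
    exact ⟨p, hp, h⟩
  have hab : a.len = b.len := by
    apply le_antisymm
    · refine le_of_forall_lt fun ξ hξ => ?_
      obtain ⟨p, hp, h⟩ := happ ξ hξ
      exact (hlen p hp ▸ h).trans_le (Node.len_le (hle p hp).2)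
    · refine le_of_forall_lt fun ξ hξ => ?_
      obtain ⟨_, ⟨p, hp, rfl⟩, h⟩ := hb' ξ hξ
      exact (hlen p hp ▸ h).trans (hlt p hp)
  have h0 : 0 < a.len := by
    obtain ⟨p, hp⟩ := hne
    exact zero_le.trans_lt (hlt p hp)
  obtain ⟨β, hβ⟩ := KappaForcing.exists_limEnum_eq (p := (a, b)) (δ := a.len) (Or.inr le_rfl)
  -- Every index below that of the union lies below the index of some member. This gives `β ≤ β₁`
  -- and transfers the prescribed bits.
  have hbelow : ∀ ξ < β, ∃ p ∈ c, ∃ β ≤ β₁, Realizes F T S s β₀ β p ∧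
      limEnum p ξ < p.1.len ∧ ξ < β := by
    intro ξ hξ
    have h1 := hβ ▸ limEnum_strictMono (a, b) hξ
    obtain ⟨p, hp, h⟩ := happ _ h1
    obtain ⟨β', hβ', hr⟩ := hcs p hp
    rw [limEnum_eq_of_lt' (hlen p hp) (hle p hp) h] at h
    exact ⟨p, hp, β', hβ', hr, h, (limEnum_strictMono p).lt_iff_lt.1 (hr.limEnum_eq ▸ h)⟩
  refine ⟨(a, b), ⟨β, ?_, ⟨⟨?_, ?_, hab, h0, fun ξ hξ => ?_⟩, hβ, fun ξ h1 h2 => ?_⟩⟩, hle⟩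
  · by_contra! h
    obtain ⟨p, hp, β', hβ', -, -, h'⟩ := hbelow _ h
    exact h'.not_ge hβ'
  · refine hT.splits_of_approx h0.ne' fun ξ hξ => ?_
    obtain ⟨p, hp, h⟩ := happ ξ hξ
    obtain ⟨_, -, hr⟩ := hcs p hp
    exact ⟨p.1, hr.fst_splits, (hle p hp).1, h, hlt p hp⟩
  · refine hS.splits_of_approx (hab ▸ h0.ne') fun ξ hξ => ?_
    obtain ⟨p, hp, h⟩ := happ ξ (hab.symm ▸ hξ)
    obtain ⟨_, -, hr⟩ := hcs p hp
    exact ⟨p.2, hr.snd_splits, (hle p hp).2, hlen p hp ▸ h, hlen p hp ▸ hab ▸ hlt p hp⟩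
  · obtain ⟨p, hp, h⟩ := happ ξ hξ
    obtain ⟨_, -, hr⟩ := hcs p hp
    obtain ⟨α, h1, h2, h3⟩ := hr.oscLim.2 ξ h
    exact ⟨α, h1, h2.trans (hlt p hp), h3.congr (fun ξ hξ => Node.val_eq (hle p hp).1 hξ)
      (fun ξ hξ => Node.val_eq (hle p hp).2 (hlen p hp ▸ hξ)) h2⟩
  · obtain ⟨p, hp, β', hβ', hr, h3, h4⟩ := hbelow ξ h2
    rw [highAt_iff_of_lt (hlen p hp) (hle p hp) h3]
    exact hr.highAt_iff ξ h1 h4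

/-- Every good pair extends to one which realizes arbitrary values of the oscillation function. -/
theorem GoodPair.exists_realizes [F.NeBot] (hκ : κ.IsInaccessible) (hT : IsMillerTree F T)
    (hS : IsMillerTree F S) (hF : ∀ α, Set.Ioi α ∈ F) {p : Node κ × Node κ}
    (hp : GoodPair F T S p) {β₀ β₁ : Ordinal.{u}} (hβ₀ : limEnum p β₀ = p.1.len) (hle : β₀ ≤ β₁)
    (hβ₁ : β₁ < κ.ord) (s : Ordinal.{u} → Prop) :
    ∃ q, p ≤ q ∧ Realizes F T S s β₀ β₁ q := by
  -- A maximal pair must have index `β₁`, since otherwise one more bit could be added. The pair `p`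
  -- starts the process with no bits prescribed.
  obtain ⟨m, hpm, hm⟩ := zorn_le_nonempty₀ {q | ∃ β ≤ β₁, Realizes F T S s β₀ β q}
    (fun c hcs hc y hy => exists_upperBound_of_chain hκ hT hS hβ₁ c hcs hc ⟨y, hy⟩) p
    ⟨β₀, hle, hp, hβ₀, fun ξ h1 h2 => absurd h2 h1.not_gt⟩
  obtain ⟨β, hβ, hr⟩ := hm.prop
  rcases hβ.eq_or_lt with rfl | hβ
  · exact ⟨m, hpm, hr⟩
  obtain ⟨q, hq, hmq, hlt, h1, h2⟩ := hr.toGoodPair.exists_next hκ hT hS hF hr.limEnum_eq (s β)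
  have hqm := hm.le_of_ge ⟨_, Order.succ_le_of_lt hβ, hq, h1, fun ξ h3 h4 => by
    rcases (Order.lt_succ_iff.1 h4).eq_or_lt with rfl | h4
    · exact h2
    · rw [highAt_iff_of_lt hr.len_eq hmq (hr.limEnum_eq ▸ limEnum_strictMono m h4)]
      exact hr.highAt_iff ξ h3 h4⟩ hmq
  exact absurd hlt (Node.len_le hqm.1).not_gt

end Good

end KappaForcing

/-! ### Regular sentences -/

namespace Forcing

section Regular

variable {P : Type u} [Preorder P] {X : Type v}

/-- A sentence is regular if it is forced by `p` iff it is forced by densely many conditions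
below `p`. -/
structure Regular (φ : Sentence P) : Prop where
  mono : ∀ {p q : P}, q ≤ p → φ p → φ q
  of_dense : ∀ {p : P}, (∀ q ≤ p, ∃ r ≤ q, φ r) → φ p

variable {φ ψ : Sentence P}

theorem regular_ground (a : Prop) : Regular (ground a : Sentence P) where
  mono _ h := h
  of_dense {p} h := let ⟨_, _, h⟩ := h p le_rfl; h

theorem Regular.conj (hφ : Regular φ) (hψ : Regular ψ) : Regular (conj φ ψ) where
  mono hq h := ⟨hφ.mono hq h.1, hψ.mono hq h.2⟩
  of_dense h := ⟨hφ.of_dense fun q hq => let ⟨r, hr, h⟩ := h q hq; ⟨r, hr, h.1⟩,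
    hψ.of_dense fun q hq => let ⟨r, hr, h⟩ := h q hq; ⟨r, hr, h.2⟩⟩

theorem Regular.imp (hφ : Regular φ) (hψ : Regular ψ) : Regular (imp φ ψ) where
  mono hq h r hr := h r (hr.trans hq)
  of_dense h q hq hφq := hψ.of_dense fun r hr =>
    let ⟨s, hs, h⟩ := h r (hr.trans hq)
    ⟨s, hs, h s le_rfl (hφ.mono (hs.trans hr) hφq)⟩

theorem regular_disj (φ ψ : Sentence P) : Regular (disj φ ψ) where
  mono hq h r hr := h r (hr.trans hq)
  of_dense h q hq :=
    let ⟨_, hr, h⟩ := h q hq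
    let ⟨s, hs, h⟩ := h _ le_rfl
    ⟨s, hs.trans hr, h⟩

theorem Regular.all {φ : X → Sentence P} (h : ∀ x, Regular (φ x)) : Regular (all φ) where
  mono hq h' x := (h x).mono hq (h' x)
  of_dense h' x := (h x).of_dense fun q hq => let ⟨r, hr, h⟩ := h' q hq; ⟨r, hr, h x⟩

theorem regular_ex (φ : X → Sentence P) : Regular (ex φ) where
  mono hq h r hr := h r (hr.trans hq)
  of_dense h q hq :=
    let ⟨_, hr, h⟩ := h q hq
    let ⟨s, hs, h⟩ := h _ le_rfl
    ⟨s, hs.trans hr, h⟩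

theorem regular_mem (τ : SetName P X) (x : X) : Regular (mem τ x) where
  mono hq h r hr := h r (hr.trans hq)
  of_dense h q hq :=
    let ⟨_, hr, h⟩ := h q hq
    let ⟨s, hs, h⟩ := h _ le_rfl
    ⟨s, hs.trans hr, h⟩

/-- Membership in a name quantifies over a dense set of stronger conditions, and regularity is
precisely what absorbs this. -/
theorem mem_sep {φ : X → Sentence P} {x : X} (h : Regular (φ x)) : mem (sep φ) x = φ x := by
  funext p
  refine propext ⟨fun hp => h.of_dense fun q hq => ?_, fun hp q hq => ⟨q, le_rfl, q, ?_, le_rfl⟩⟩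
  · obtain ⟨r, hr, t, ht, hrt⟩ := hp q hq
    exact ⟨r, hr, h.mono hrt ht⟩
  · exact h.mono hq hp

theorem mem_genericFilter {x p : P} :
    mem (genericFilter P) x p ↔ ∀ q ≤ p, ∃ r ≤ q, r ≤ x := by
  refine forall₂_congr fun q _ => exists_congr fun r => and_congr_right fun _ => ?_
  exact ⟨fun ⟨t, ht, h⟩ => (show x = t from ht) ▸ h, fun h => ⟨x, rfl, h⟩⟩

variable {Q : Type v} [Preorder Q]

theorem mem_fstProj_genericFilter {x : P} {p : P × Q} :
    mem (fstProj (genericFilter (P × Q))) x p ↔ ∀ q ≤ p, ∃ r ≤ q, r.1 ≤ x := by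
  rw [fstProj, mem_sep (φ := fun x : P => ex fun y : Q => mem (genericFilter (P × Q)) (x, y))
    (regular_ex _)]
  refine forall₂_congr fun q _ => ⟨fun ⟨r, hr, y, h⟩ => ?_, fun ⟨r, hr, h⟩ => ?_⟩
  · obtain ⟨s, hs, h⟩ := mem_genericFilter.1 h r le_rfl
    exact ⟨s, hs.trans hr, h.1⟩
  · exact ⟨r, hr, r.2, mem_genericFilter.2 fun s hs => ⟨s, le_rfl, hs.1.trans h, hs.2⟩⟩

theorem mem_sndProj_genericFilter {y : Q} {p : P × Q} :
    mem (sndProj (genericFilter (P × Q))) y p ↔ ∀ q ≤ p, ∃ r ≤ q, r.2 ≤ y := by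
  rw [sndProj, mem_sep (φ := fun y : Q => ex fun x : P => mem (genericFilter (P × Q)) (x, y))
    (regular_ex _)]
  refine forall₂_congr fun q _ => ⟨fun ⟨r, hr, x, h⟩ => ?_, fun ⟨r, hr, h⟩ => ?_⟩
  · obtain ⟨s, hs, h⟩ := mem_genericFilter.1 h r le_rfl
    exact ⟨s, hs.trans hr, h.2⟩
  · exact ⟨r, hr, r.1, mem_genericFilter.2 fun s hs => ⟨s, le_rfl, hs.1, hs.2.trans h⟩⟩

end Regular

end Forcing

namespace KappaForcing

open Forcing

variable {κ : Cardinal.{u}} {F : Filter (Below κ)}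

/-! ### Conditions deciding initial segments of the Miller functions -/

/-- The condition `p` decides the initial segments `u` of the two Miller functions. -/
structure Decides (p : Miller F × Miller F) (u : Node κ × Node κ) : Prop where
  len_eq : u.1.len = u.2.len
  fst_mem : u.1 ∈ p.1.1
  snd_mem : u.2 ∈ p.2.1
  fst_subset : p.1.1 ⊆ subtree p.1.1 u.1
  snd_subset : p.2.1 ⊆ subtree p.2.1 u.2

/-- All nodes of the smaller tree are comparable with `u`, and it has nodes at least as long as `u`;
these extend `u`, which therefore belongs to it. -/
theorem Decides.mono [F.NeBot] {p q : Miller F × Miller F} {u : Node κ × Node κ}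
    (h : Decides p u) (hq : q ≤ p) : Decides q u := by
  have h1 : ∀ v ∈ q.1.1, v ∈ subtree q.1.1 u.1 := fun v hv => ⟨hv, (h.fst_subset (hq.1 hv)).2⟩
  have h2 : ∀ v ∈ q.2.1, v ∈ subtree q.2.1 u.2 := fun v hv => ⟨hv, (h.snd_subset (hq.2 hv)).2⟩
  refine ⟨h.len_eq, ?_, ?_, h1, h2⟩
  · obtain ⟨v, hv⟩ := q.1.2.nonempty
    obtain ⟨w, hw, -, hl⟩ := q.1.2.exists_extension hv u.1.len_lt
    exact q.1.2.mem_of_le hw (le_of_mem_subtree (h1 w hw) hl)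
  · obtain ⟨v, hv⟩ := q.2.2.nonempty
    obtain ⟨w, hw, -, hl⟩ := q.2.2.exists_extension hv u.2.len_lt
    exact q.2.2.mem_of_le hw (le_of_mem_subtree (h2 w hw) hl)

theorem Decides.le_of_len_le {p : Miller F × Miller F} {u v : Node κ × Node κ}
    (hu : Decides p u) (hv : Decides p v) (h : u.1.len ≤ v.1.len) : u ≤ v :=
  ⟨le_of_mem_subtree (hu.fst_subset hv.fst_mem) h,
    le_of_mem_subtree (hu.snd_subset hv.snd_mem) (hu.len_eq ▸ hv.len_eq ▸ h)⟩

theorem exists_le_decides [F.NeBot] (hF : ∀ α, Set.Ioi α ∈ F) (p : Miller F × Miller F)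
    {u : Node κ × Node κ} (h1 : u.1 ∈ p.1.1) (h2 : u.2 ∈ p.2.1) (hl : u.1.len = u.2.len) :
    ∃ q ≤ p, Decides q u :=
  ⟨(⟨_, p.1.2.subtree hF h1⟩, ⟨_, p.2.2.subtree hF h2⟩), ⟨subtree_subset, subtree_subset⟩, hl,
    mem_subtree_of_le h1 le_rfl, mem_subtree_of_le h2 le_rfl, fun _ hv => ⟨hv, hv.2⟩,
    fun _ hv => ⟨hv, hv.2⟩⟩

/-! ### Absoluteness of sentences about the Miller functions -/

/-- If `p` decides initial segments `u` such that `D u`, then `p` forces `φ` iff `R u` holds. -/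
structure Eval (φ : Sentence (Miller F × Miller F)) (D R : Node κ × Node κ → Prop) : Prop where
  regular : Regular φ
  iff : ∀ {p u}, Decides p u → D u → (φ p ↔ R u)

section Eval

variable {X : Type w} {φ ψ : Sentence (Miller F × Miller F)} {D D' R R' : Node κ × Node κ → Prop}

theorem Eval.congr (h : Eval φ D R)
    (h' : ∀ p u, Decides (F := F) p u → D' u → D u ∧ (R u ↔ R' u)) : Eval φ D' R' :=
  ⟨h.regular, fun hp hu => (h.iff hp (h' _ _ hp hu).1).trans (h' _ _ hp hu).2⟩

theorem eval_ground (a : Prop) (D : Node κ × Node κ → Prop) :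
    Eval (F := F) (ground a) D fun _ => a :=
  ⟨regular_ground a, fun _ _ => Iff.rfl⟩

/-- The second conjunct is evaluated only where the first is true, so a bound such as `β < α` can
guarantee that `u` is long enough for it. -/
theorem Eval.conj (hφ : Eval φ D R) (hψ : Eval ψ (fun u => D u ∧ R u) R') :
    Eval (conj φ ψ) D fun u => R u ∧ R' u :=
  ⟨hφ.regular.conj hψ.regular, fun hp hu =>
    (and_congr_left' (hφ.iff hp hu)).trans (and_congr_right fun h => hψ.iff hp ⟨hu, h⟩)⟩

theorem Eval.imp [F.NeBot] (hφ : Eval φ D R) (hψ : Eval ψ (fun u => D u ∧ R u) R') :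
    Eval (imp φ ψ) D fun u => R u → R' u :=
  ⟨hφ.regular.imp hψ.regular, fun {p _} hp hu =>
    ⟨fun h hR => (hψ.iff hp ⟨hu, hR⟩).1 (h p le_rfl ((hφ.iff hp hu).2 hR)), fun h q hq hφq =>
      have hR := (hφ.iff (hp.mono hq) hu).1 hφq
      (hψ.iff (hp.mono hq) ⟨hu, hR⟩).2 (h hR)⟩⟩

theorem Eval.disj [F.NeBot] (hφ : Eval φ D R) (hψ : Eval ψ D R') :
    Eval (disj φ ψ) D fun u => R u ∨ R' u :=
  ⟨regular_disj _ _, fun {p _} hp hu => ⟨fun h =>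
    let ⟨_, hr, h⟩ := h p le_rfl
    h.imp (hφ.iff (hp.mono hr) hu).1 (hψ.iff (hp.mono hr) hu).1, fun h q hq =>
    ⟨q, le_rfl, h.imp (hφ.iff (hp.mono hq) hu).2 (hψ.iff (hp.mono hq) hu).2⟩⟩⟩

theorem Eval.all {φ : X → Sentence (Miller F × Miller F)} {R : X → Node κ × Node κ → Prop}
    (h : ∀ x, Eval (φ x) D (R x)) : Eval (all φ) D fun u => ∀ x, R x u :=
  ⟨Regular.all fun x => (h x).regular, fun hp hu => forall_congr' fun x => (h x).iff hp hu⟩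

theorem Eval.ex [F.NeBot] {φ : X → Sentence (Miller F × Miller F)}
    {R : X → Node κ × Node κ → Prop} (h : ∀ x, Eval (φ x) D (R x)) :
    Eval (ex φ) D fun u => ∃ x, R x u :=
  ⟨regular_ex _, fun {p _} hp hu => ⟨fun h' =>
    let ⟨_, hr, x, h'⟩ := h' p le_rfl
    ⟨x, ((h x).iff (hp.mono hr) hu).1 h'⟩, fun ⟨x, h'⟩ q hq =>
    ⟨q, le_rfl, x, ((h x).iff (hp.mono hq) hu).2 h'⟩⟩⟩

theorem Eval.mem_sep {φ : X → Sentence (Miller F × Miller F)} {x : X} (h : Eval (φ x) D R) :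
    Eval (mem (sep φ) x) D R := by
  rwa [Forcing.mem_sep h.regular]

end Eval

/-- The name `f` is evaluated by `val`. -/
structure EvalFun (f : SetName (Miller F × Miller F) (Below κ × Below κ))
    (val : Node κ × Node κ → Ordinal.{u} → Ordinal.{u}) : Prop where
  eval : ∀ α β : Below κ, Eval (mem f (α, β)) (fun u => (α : Ordinal) < u.1.len)
    fun u => val u α = β
  lt : ∀ {p u}, Decides (F := F) p u → ∀ ξ < u.1.len, val u ξ < κ.ord

theorem mem_millerFunction {P : Type v} [Preorder P] (G : SetName P (Miller F))
    (α β : Below κ) : mem (millerFunction G) (α, β) =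
      ex fun u : Node κ => conj (all fun T : Miller F => imp (mem G T) (ground (u ∈ T.1)))
      (ground ((α : Ordinal) < u.len ∧ u.val α = β)) :=
  mem_sep (φ := fun a : Below κ × Below κ => ex fun u : Node κ =>
    conj (all fun T : Miller F => imp (mem G T) (ground (u ∈ T.1)))
      (ground ((a.1 : Ordinal) < u.len ∧ u.val a.1 = a.2))) (regular_ex _)

/-- A node in all trees of the generic filter lies in the tree of the condition at hand, so it
agrees with `u`. Conversely, a common strengthening with any tree of the filter still decides `u`,
which puts `u` into that tree. -/
theorem evalFun_m₀ [F.NeBot] : EvalFun (m₀ F) fun u => u.1.val where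
  eval α β := by
    refine ⟨regular_mem _ _, fun {p u} hp hu => ?_⟩
    rw [m₀, mem_millerFunction]
    constructor
    · intro h
      obtain ⟨r, hr, v, h1, h2, h3⟩ := h p le_rfl
      have hv : v ∈ r.1.1 :=
        h1 r.1 r le_rfl (mem_fstProj_genericFilter.2 fun q hq => ⟨q, le_rfl, hq.1⟩)
      rw [← ((hp.mono hr).fst_subset hv).2 _ h2 hu, h3]
    · intro h q hq
      refine ⟨q, le_rfl, u.1, fun T r hr hT => ?_, hu, h⟩
      obtain ⟨s, hs, hsT⟩ := mem_fstProj_genericFilter.1 hT r le_rfl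
      exact hsT (hp.mono ((hs.trans hr).trans hq)).fst_mem
  lt {_ u} _ := u.1.val_lt

theorem evalFun_m₁ [F.NeBot] : EvalFun (m₁ F) fun u => u.2.val where
  eval α β := by
    refine ⟨regular_mem _ _, fun {p u} hp hu => ?_⟩
    rw [hp.len_eq] at hu
    rw [m₁, mem_millerFunction]
    constructor
    · intro h
      obtain ⟨r, hr, v, h1, h2, h3⟩ := h p le_rfl
      have hv : v ∈ r.2.1 :=
        h1 r.2 r le_rfl (mem_sndProj_genericFilter.2 fun q hq => ⟨q, le_rfl, hq.2⟩)
      rw [← ((hp.mono hr).snd_subset hv).2 _ h2 hu, h3]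
    · intro h q hq
      refine ⟨q, le_rfl, u.2, fun T r hr hT => ?_, hu, h⟩
      obtain ⟨s, hs, hsT⟩ := mem_sndProj_genericFilter.1 hT r le_rfl
      exact hsT (hp.mono ((hs.trans hr).trans hq)).snd_mem
  lt {_ u} hp ξ hξ := u.2.val_lt ξ (hp.len_eq ▸ hξ)

/-! ### Evaluation of oscillation points and of their limits -/

section Osc

variable {f g : SetName (Miller F × Miller F) (Below κ × Below κ)}
  {a b : Node κ × Node κ → Ordinal.{u} → Ordinal.{u}}

theorem EvalFun.eval_valRel [F.NeBot] (hf : EvalFun f a) (hg : EvalFun g b) (R : Below κ → Below κ → Prop)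
    (r : Ordinal.{u} → Ordinal.{u} → Prop) (hR : ∀ x y : Below κ, R x y ↔ r x y) (α : Below κ) :
    Eval (valRel R f g α) (fun u => (α : Ordinal) < u.1.len) fun u => r (a u α) (b u α) := by
  refine Eval.congr (Eval.ex fun x => Eval.ex fun y => (hf.eval α x).conj
    (((hg.eval α y).congr fun p u _ h => ⟨h.1, Iff.rfl⟩).conj (eval_ground _ _)))
    fun p u hp hu => ⟨hu, ⟨?_, fun h => ⟨⟨_, hf.lt hp _ hu⟩, ⟨_, hg.lt hp _ hu⟩, rfl, rfl, ?_⟩⟩⟩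
  · rintro ⟨x, y, hx, hy, h⟩
    rw [hx, hy]
    exact (hR x y).1 h
  · exact (hR _ _).2 h

theorem EvalFun.eval_crossesAt [F.NeBot] (hf : EvalFun f a) (hg : EvalFun g b) (γ α : Below κ) :
    Eval (crossesAt f g γ α) (fun u => (α : Ordinal) < u.1.len) fun u =>
      b u α < a u α ∧ ∀ β : Below κ, γ ≤ β ∧ β < α → a u β < b u β :=
  (hf.eval_valRel hg _ (· > ·) (fun _ _ => Subtype.coe_lt_coe.symm) α).conj <| Eval.all fun β =>
    (eval_ground _ _).imp <|
      (hf.eval_valRel hg _ (· < ·) (fun _ _ => Subtype.coe_lt_coe.symm) β).congr fun _ _ _ h =>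
        ⟨(Subtype.coe_lt_coe.2 h.2.2).trans h.1.1, Iff.rfl⟩

theorem EvalFun.eval_oscPoints [F.NeBot] (hf : EvalFun f a) (hg : EvalFun g b) (α : Below κ) :
    Eval (mem (oscPoints f g) α) (fun u => (α : Ordinal) < u.1.len) fun u =>
      Osc (a u) (b u) α := by
  refine Eval.mem_sep (Eval.congr (Eval.ex fun γ => (eval_ground _ _).conj
    (((hf.eval_crossesAt hg γ α).disj (hg.eval_crossesAt hf γ α)).congr fun _ _ _ h => ⟨h.1, Iff.rfl⟩))
    fun p u hp hu => ⟨hu, ⟨?_, ?_⟩⟩)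
  · rintro ⟨γ, hγ, h⟩
    exact ⟨γ, hγ, h.imp
      (And.imp_right fun h β h1 h2 => h ⟨β, h2.trans α.2⟩ ⟨h1, h2⟩)
      (And.imp_right fun h β h1 h2 => h ⟨β, h2.trans α.2⟩ ⟨h1, h2⟩)⟩
  · rintro ⟨γ, hγ, h⟩
    exact ⟨⟨γ, hγ.trans α.2⟩, hγ, h.imp
      (And.imp_right fun h β h1 => h β h1.1 h1.2) (And.imp_right fun h β h1 => h β h1.1 h1.2)⟩

/-- Only points strictly below `δ` are consulted, so the required length drops from `<` to `≤`.
Hence a pair decides whether its own length is a limit point. -/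
theorem Eval.limitPoints [F.NeBot] {A : SetName (Miller F × Miller F) (Below κ)}
    {R : Below κ → Node κ × Node κ → Prop}
    (hA : ∀ α : Below κ, Eval (mem A α) (fun u => (α : Ordinal) < u.1.len) (R α)) (δ : Below κ) :
    Eval (mem (limitPoints A) δ) (fun u => (δ : Ordinal) ≤ u.1.len) fun u =>
      0 < (δ : Ordinal) ∧ ∀ ξ < δ, ∃ α, (ξ < α ∧ α < δ) ∧ R α u :=
  Eval.mem_sep ((eval_ground _ _).conj (Eval.all fun ξ : Below κ =>
    (eval_ground _ _).imp (Eval.ex fun α : Below κ => (eval_ground _ _).conj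
      ((hA α).congr fun _ _ _ h =>
        ⟨(Subtype.coe_lt_coe.2 h.2.2).trans_le h.1.1.1, Iff.rfl⟩))))

theorem EvalFun.eval_limitPoints [F.NeBot] (hf : EvalFun f a) (hg : EvalFun g b) (δ : Below κ) :
    Eval (mem (limitPoints (oscPoints f g)) δ) (fun u => (δ : Ordinal) ≤ u.1.len) fun u =>
      OscLim (a u) (b u) δ := by
  refine (Eval.limitPoints (hf.eval_oscPoints hg) δ).congr fun p u _ hu =>
    ⟨hu, and_congr_right fun _ => ⟨fun h ξ hξ => ?_, fun h ξ hξ => ?_⟩⟩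
  · obtain ⟨α, h1, h2⟩ := h ⟨ξ, hξ.trans δ.2⟩ hξ
    exact ⟨α, h1.1, h1.2, h2⟩
  · obtain ⟨α, h1, h2, h3⟩ := h ξ hξ
    exact ⟨⟨α, h2.trans δ.2⟩, ⟨h1, h2⟩, h3⟩

end Osc

/-- The name for the increasing enumeration of the limits of oscillation points of the Miller
functions. -/
def enumName (F : Filter (Below κ)) : SetName (Miller F × Miller F) (Below κ × Below κ) :=
  {x | ∃ u, Decides x.2 u ∧ limEnum u x.1.1 < u.1.len ∧ limEnum u x.1.1 = x.1.2}

/-- Two pairs decided by a common condition are comparable, and their enumerations agree below the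
shorter length. -/
theorem eval_enumName [F.NeBot] (α δ : Below κ) :
    Eval (mem (enumName F) (α, δ)) (fun u => limEnum u α < u.1.len) fun u => limEnum u α = δ := by
  refine ⟨regular_mem _ _, fun {p u} hp hu => ⟨fun h => ?_, fun h q hq =>
    ⟨q, le_rfl, q, ⟨u, hp.mono hq, hu, h⟩, le_rfl⟩⟩⟩
  obtain ⟨r, hr, t, ⟨v, hv, h1, h2⟩, hrt⟩ := h p le_rfl
  replace hv := hv.mono hrt
  replace hp := hp.mono hr
  rw [← h2]
  rcases le_total u.1.len v.1.len with hl | hl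
  · exact (limEnum_eq_of_lt hp.len_eq (hp.le_of_len_le hv hl) hu).symm
  · exact limEnum_eq_of_lt hv.len_eq (hv.le_of_len_le hp hl) h1

theorem eval_oscFunction [F.NeBot] (α : Below κ) (i : Fin 2) :
    Eval (mem (oscFunction (m₀ F) (m₁ F) (enumName F)) (α, i)) (fun u => limEnum u α < u.1.len)
      fun u => i = 1 ↔ HighAt u α := by
  refine Eval.mem_sep (Eval.congr (Eval.ex fun δ : Below κ => (eval_enumName α δ).conj
    (Eval.disj
      ((eval_ground _ _).conj ((evalFun_m₀.eval_valRel evalFun_m₁ _ (· ≤ ·)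
        (fun _ _ => Subtype.coe_le_coe.symm) δ).congr fun _ _ _ h => ⟨?_, Iff.rfl⟩))
      ((eval_ground _ _).conj ((evalFun_m₀.eval_valRel evalFun_m₁ _ (· > ·)
        (fun _ _ => Subtype.coe_lt_coe.symm) δ).congr fun _ _ _ h => ⟨?_, Iff.rfl⟩))))
    fun p u hp hu => ⟨hu, ⟨?_, fun h => ⟨⟨_, hu.trans u.1.len_lt⟩, rfl, ?_⟩⟩⟩)
  · exact h.1.2 ▸ h.1.1
  · exact h.1.2 ▸ h.1.1
  · rintro ⟨δ, hδ, ⟨rfl, h⟩ | ⟨rfl, h⟩⟩ <;> rw [HighAt, hδ]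
    · exact iff_of_false (by decide) (not_lt.2 h)
    · exact iff_of_true rfl h
  · by_cases h' : HighAt u α
    · exact Or.inr ⟨h.2 h', h'⟩
    · exact Or.inl ⟨show i = 0 by have := mt h.1 h'; omega, not_lt.1 h'⟩

/-! ### Density -/

theorem exists_le_decides_oscLim [F.NeBot] (hκ : κ.IsInaccessible) (hF : ∀ α, Set.Ioi α ∈ F)
    (p : Miller F × Miller F) {ξ : Ordinal.{u}} (hξ : ξ < κ.ord) :
    ∃ q ≤ p, ∃ u, Decides q u ∧ ξ < u.1.len ∧ OscLim u.1.val u.2.val u.1.len := by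
  obtain ⟨a, ha⟩ := p.1.2.nonempty
  obtain ⟨b, hb⟩ := p.2.2.nonempty
  obtain ⟨u, hu, -, -, h⟩ := exists_goodPair hκ p.1.2 p.2.2 hF ha hb hξ
  obtain ⟨q, hq, hqu⟩ := exists_le_decides hF p hu.fst_splits.1 hu.snd_splits.1 hu.len_eq
  exact ⟨q, hq, u, hqu, h, hu.oscLim⟩

/-- Every condition decides only a bounded part of the oscillation function, and the rest can be
prescribed. -/
theorem exists_le_decides_highAt [F.NeBot] (hκ : κ.IsInaccessible) (hF : ∀ α, Set.Ioi α ∈ F)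
    (p : Miller F × Miller F) :
    ∃ β₀ < κ.ord, ∃ t : Ordinal.{u} → Prop, ∀ β₁, β₀ ≤ β₁ → β₁ < κ.ord → ∀ s : Ordinal.{u} → Prop,
      (∀ ξ < β₀, s ξ ↔ t ξ) → ∃ q ≤ p, ∃ u, Decides q u ∧ limEnum u β₁ = u.1.len ∧
        ∀ ξ < β₁, HighAt u ξ ↔ s ξ := by
  obtain ⟨a, ha⟩ := p.1.2.nonempty
  obtain ⟨b, hb⟩ := p.2.2.nonempty
  -- Any good pair will do; the length bound is arbitrary. Its index becomes `β₀` and its bits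
  -- become `t`.
  obtain ⟨u, hu, -⟩ := exists_goodPair hκ p.1.2 p.2.2 hF ha hb a.len_lt
  obtain ⟨β₀, hβ₀, h⟩ := hu.exists_limEnum_eq
  refine ⟨β₀, hβ₀, HighAt u, fun β₁ hle hβ₁ s hs => ?_⟩
  obtain ⟨v, huv, hv⟩ := hu.exists_realizes hκ p.1.2 p.2.2 hF h hle hβ₁ s
  obtain ⟨q, hq, hqv⟩ := exists_le_decides hF p hv.fst_splits.1 hv.snd_splits.1 hv.len_eq
  refine ⟨q, hq, v, hqv, hv.limEnum_eq, fun ξ hξ => ?_⟩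
  rcases lt_or_ge ξ β₀ with h' | h'
  · rw [hs ξ h', highAt_iff_of_lt hu.len_eq huv (h ▸ limEnum_strictMono u h')]
  · exact hv.highAt_iff ξ h' hξ

theorem exists_le_decides_limEnum_lt [F.NeBot] (hκ : κ.IsInaccessible)
    (hF : ∀ α, Set.Ioi α ∈ F) (p : Miller F × Miller F) (α : Below κ) :
    ∃ q ≤ p, ∃ u, Decides q u ∧ limEnum u α < u.1.len := by
  obtain ⟨β₀, hβ₀, t, h⟩ := exists_le_decides_highAt hκ hF p
  have hlim := Cardinal.isSuccLimit_ord hκ.aleph0_lt.le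
  obtain ⟨q, hq, u, hu, h1, -⟩ := h (max β₀ (Order.succ α)) (le_max_left _ _)
    (max_lt hβ₀ (hlim.succ_lt α.2)) t fun _ _ => Iff.rfl
  exact ⟨q, hq, u, hu, h1 ▸ limEnum_strictMono u ((Order.lt_succ _).trans_le (le_max_right _ _))⟩

/-! ### The generic filter of Cohen forcing -/

/-- The name for the set of all Cohen conditions contained in the oscillation function. -/
def cohenFilter (F : Filter (Below κ)) : SetName (Miller F × Miller F) (CohenCond κ) :=
  sep fun s => all fun α : Below κ => all fun i : Fin 2 => imp (ground (s.val α = some i))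
    (mem (oscFunction (m₀ F) (m₁ F) (enumName F)) (α, i))

theorem mem_cohenFilter {s : CohenCond κ} {p : Miller F × Miller F} :
    mem (cohenFilter F) s p ↔ ∀ α i, s.val α = some i →
      mem (oscFunction (m₀ F) (m₁ F) (enumName F)) (α, i) p := by
  rw [cohenFilter, mem_sep (φ := fun s : CohenCond κ => all fun α : Below κ => all fun i : Fin 2 =>
    imp (ground (s.val α = some i)) (mem (oscFunction (m₀ F) (m₁ F) (enumName F)) (α, i)))
    (Regular.all fun α => Regular.all fun i => (regular_ground _).imp (regular_mem _ _))]
  exact ⟨fun h α i hi => h α i p le_rfl hi, fun h α i q hq hi => (regular_mem _ _).mono hq (h α i hi)⟩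

theorem CohenCond.exists_common_extension (hκ : κ.IsInaccessible)
    (s t : CohenCond κ) (h : ∀ α i j, s.val α = some i → t.val α = some j → i = j) :
    ∃ r : CohenCond κ, r ≤ s ∧ r ≤ t ∧
      ∀ α i, r.val α = some i → s.val α = some i ∨ t.val α = some i := by
  refine ⟨⟨fun α => (s.val α).or (t.val α), ?_⟩, fun α i hi => ?_, fun α i hi => ?_,
    fun α i hi => ?_⟩
  · refine (Cardinal.mk_le_mk_of_subset (t := {α | s.val α ≠ none} ∪ {α | t.val α ≠ none}) ?_).trans_lt
      ((Cardinal.mk_union_le _ _).trans_lt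
      (Cardinal.add_lt_of_lt (Cardinal.aleph0_le_lift.2 hκ.aleph0_lt.le) s.card_dom_lt t.card_dom_lt))
    intro α hα
    by_contra! h'
    simp only [Set.mem_union, Set.mem_ofPred_eq, not_or, not_not] at h'
    exact hα (by simp [h'.1, h'.2])
  · simp [hi]
  · rcases hs : s.val α with _ | j
    · simp [hs, hi]
    · simp [hs, h α j i hs hi]
  · rcases hs : s.val α with _ | j
    · exact Or.inr (by simpa [hs] using hi)
    · exact Or.inl (by simpa [hs] using hi)

/-! ### The Miller functions and their oscillation -/

section Forced

variable [F.NeBot]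

theorem EvalFun.forces_isFunction (hκ : κ.IsInaccessible) (hF : ∀ α, Set.Ioi α ∈ F)
    {f : SetName (Miller F × Miller F) (Below κ × Below κ)}
    {a : Node κ × Node κ → Ordinal.{u} → Ordinal.{u}} (hf : EvalFun f a)
    (p : Miller F × Miller F) : isFunction f p := by
  intro α q _
  obtain ⟨r, hr, u, hu, h, -⟩ := exists_le_decides_oscLim hκ hF q α.2
  refine ⟨r, hr, ⟨a u α, hf.lt hu _ h⟩, ((hf.eval _ _).iff hu h).2 rfl, fun β s hs hβ => ?_⟩
  exact Subtype.ext (((hf.eval α β).iff (hu.mono hs) h).1 hβ).symm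

theorem eval_oscPoints (α : Below κ) :
    Eval (mem (oscPoints (m₀ F) (m₁ F)) α) (fun u => (α : Ordinal) < u.1.len) fun u =>
      Osc u.1.val u.2.val α :=
  evalFun_m₀.eval_oscPoints evalFun_m₁ α

theorem eval_limitPoints (δ : Below κ) :
    Eval (mem (limitPoints (oscPoints (m₀ F) (m₁ F))) δ) (fun u => (δ : Ordinal) ≤ u.1.len)
      fun u => OscLim u.1.val u.2.val δ :=
  evalFun_m₀.eval_limitPoints evalFun_m₁ δ

theorem forces_isUnbounded_oscPoints (hκ : κ.IsInaccessible) (hF : ∀ α, Set.Ioi α ∈ F)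
    (p : Miller F × Miller F) : isUnbounded (oscPoints (m₀ F) (m₁ F)) p := by
  intro ξ q _
  obtain ⟨r, hr, u, hu, h, h'⟩ := exists_le_decides_oscLim hκ hF q ξ.2
  obtain ⟨α, h1, h2, h3⟩ := h'.2 ξ h
  exact ⟨r, hr, ⟨α, h2.trans u.1.len_lt⟩, h1, ((eval_oscPoints _).iff hu h2).2 h3⟩

theorem forces_isUnbounded_limitPoints (hκ : κ.IsInaccessible) (hF : ∀ α, Set.Ioi α ∈ F)
    (p : Miller F × Miller F) : isUnbounded (limitPoints (oscPoints (m₀ F) (m₁ F))) p := by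
  intro ξ q _
  obtain ⟨r, hr, u, hu, h, h'⟩ := exists_le_decides_oscLim hκ hF q ξ.2
  exact ⟨r, hr, ⟨u.1.len, u.1.len_lt⟩, h, ((eval_limitPoints _).iff hu le_rfl).2 h'⟩

theorem forces_isClub_limitPoints (hκ : κ.IsInaccessible) (hF : ∀ α, Set.Ioi α ∈ F)
    (p : Miller F × Miller F) : isClub (limitPoints (oscPoints (m₀ F) (m₁ F))) p := by
  refine ⟨forces_isUnbounded_limitPoints hκ hF p, fun δ q _ h => (regular_mem _ _).of_dense ?_⟩
  intro q' hq'
  obtain ⟨r, hr, u, hu, hδ, -⟩ := exists_le_decides_oscLim hκ hF q' δ.2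
  refine ⟨r, hr, ((eval_limitPoints δ).iff hu hδ.le).2 ?_⟩
  have hlim := ((Eval.limitPoints (fun α => (eval_limitPoints α).congr fun _ _ _ h =>
    ⟨h.le, Iff.rfl⟩) δ).iff hu hδ.le).1 ((regular_mem _ _).mono (hr.trans hq') h)
  refine OscLim.of_limit hlim.1 fun ξ hξ => ?_
  obtain ⟨α, h1, h2⟩ := hlim.2 ⟨ξ, hξ.trans δ.2⟩ hξ
  exact ⟨α, h1.1, (Subtype.coe_lt_coe.2 h1.2).le, h2⟩

/-- Each clause is checked below a condition deciding a long enough pair, where it becomes a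
property of `limEnum`. Continuity is its normality. -/
theorem forces_isEnumeration (hκ : κ.IsInaccessible) (hF : ∀ α, Set.Ioi α ∈ F)
    (p : Miller F × Miller F) :
    isEnumeration (enumName F) (limitPoints (oscPoints (m₀ F) (m₁ F))) p := by
  refine ⟨fun α q _ => ?_, fun α β q _ hαβ q' hq' => ?_, fun δ => ⟨fun q _ h q' hq' => ?_,
    fun q _ h => (regular_mem _ _).of_dense fun q' hq' => ?_⟩, fun l δ ξ q _ h q' hq' => ?_⟩
  · obtain ⟨r, hr, u, hu, h⟩ := exists_le_decides_limEnum_lt hκ hF q α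
    refine ⟨r, hr, ⟨_, h.trans u.1.len_lt⟩, ((eval_enumName _ _).iff hu h).2 rfl,
      fun β s hs hβ => ?_⟩
    exact Subtype.ext (((eval_enumName α β).iff (hu.mono hs) h).1 hβ).symm
  · obtain ⟨r, hr, u, hu, h⟩ := exists_le_decides_limEnum_lt hκ hF q' β
    have hlt := limEnum_strictMono u (Subtype.coe_lt_coe.2 hαβ)
    exact ⟨r, hr, ⟨_, (hlt.trans h).trans u.1.len_lt⟩, fun s hs => ⟨s, le_rfl,
      ⟨_, h.trans u.1.len_lt⟩, ((eval_enumName _ _).iff (hu.mono hs) (hlt.trans h)).2 rfl,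
      ((eval_enumName _ _).iff (hu.mono hs) h).2 rfl, hlt⟩⟩
  · obtain ⟨r, hr, u, hu, hδ, -⟩ := exists_le_decides_oscLim hκ hF q' δ.2
    have hlim := ((eval_limitPoints δ).iff hu hδ.le).1 ((regular_mem _ _).mono (hr.trans hq') h)
    obtain ⟨α, hα⟩ := exists_limEnum_eq (p := u) (δ := δ) (Or.inl hlim)
    exact ⟨r, hr, ⟨α, ((limEnum_strictMono u).le_apply.trans hα.le).trans_lt δ.2⟩,
      ((eval_enumName _ _).iff hu (hα.trans_lt hδ)).2 hα⟩
  · obtain ⟨r, hr, α, hα⟩ := h q' hq'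
    obtain ⟨s, hs, u, hu, h'⟩ := exists_le_decides_limEnum_lt hκ hF r α
    have heq := ((eval_enumName _ _).iff hu h').1 ((regular_mem _ _).mono hs hα)
    exact ⟨s, hs.trans hr, ((eval_limitPoints δ).iff hu (heq ▸ h'.le)).2
      (heq ▸ oscLim_limEnum h')⟩
  · obtain ⟨r, hr, u, hu, h'⟩ := exists_le_decides_limEnum_lt hκ hF q' l
    have heq := ((eval_enumName _ _).iff hu h').1 ((regular_mem _ _).mono (hr.trans hq') h.2)
    obtain ⟨α, hα, hξ⟩ : ∃ α < (l : Ordinal), ξ < limEnum u α := by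
      refine ((limEnum_isNormal u).lt_iff_exists_lt h.1.1).1 ?_
      rw [heq]
      exact h.1.2
    have hlt := (limEnum_strictMono u hα).trans h'
    exact ⟨r, hr, ⟨α, hα.trans l.2⟩, fun s hs => ⟨s, le_rfl, ⟨_, hlt.trans u.1.len_lt⟩,
      ((eval_enumName _ _).iff (hu.mono hs) hlt).2 rfl, hα, hξ⟩⟩

theorem forces_isFunction_oscFunction (hκ : κ.IsInaccessible) (hF : ∀ α, Set.Ioi α ∈ F)
    (p : Miller F × Miller F) : isFunction (oscFunction (m₀ F) (m₁ F) (enumName F)) p := by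
  intro α q _
  obtain ⟨r, hr, u, hu, h⟩ := exists_le_decides_limEnum_lt hκ hF q α
  obtain ⟨i, hi⟩ : ∃ i : Fin 2, i = 1 ↔ HighAt u α := by
    by_cases h : HighAt u α
    · exact ⟨1, iff_of_true rfl h⟩
    · exact ⟨0, iff_of_false (by decide) h⟩
  refine ⟨r, hr, i, ((eval_oscFunction α i).iff hu h).2 hi, fun j s hs hj => ?_⟩
  have hj' := ((eval_oscFunction α j).iff (hu.mono hs) h).1 hj
  have : i = 1 ↔ j = 1 := hi.trans hj'.symm
  show j = i
  omega

/-! ### Genericity -/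

theorem eq_of_mem_oscFunction (hκ : κ.IsInaccessible) (hF : ∀ α, Set.Ioi α ∈ F)
    {p : Miller F × Miller F} {α : Below κ} {i j : Fin 2}
    (hi : mem (oscFunction (m₀ F) (m₁ F) (enumName F)) (α, i) p)
    (hj : mem (oscFunction (m₀ F) (m₁ F) (enumName F)) (α, j) p) : i = j := by
  obtain ⟨q, hq, k, -, hk⟩ := forces_isFunction_oscFunction hκ hF p α p le_rfl
  have h1 : i = k := hk i q le_rfl ((regular_mem _ _).mono hq hi)
  have h2 : j = k := hk j q le_rfl ((regular_mem _ _).mono hq hj)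
  exact h1.trans h2.symm

theorem exists_dense_mem_cohenFilter (hκ : κ.IsInaccessible) (hF : ∀ α, Set.Ioi α ∈ F)
    {D : Set (CohenCond κ)} (hD : IsDense D) (p : Miller F × Miller F) :
    ∃ q ≤ p, ∃ d ∈ D, mem (cohenFilter F) d q := by
  classical
  have hlim := Cardinal.isSuccLimit_ord hκ.aleph0_lt.le
  obtain ⟨β₀, hβ₀, t, h⟩ := exists_le_decides_highAt hκ hF p
  -- The Cohen condition coding the pattern already fixed on `β₀`. Any extension of it is compatible
  -- with what can be realized below `p`.
  let t₀ : CohenCond κ := ⟨fun α => if (α : Ordinal) < β₀ then some (if t α then 1 else 0) else none,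
    (Cardinal.mk_le_mk_of_subset (t := Set.Iic (⟨β₀, Set.mem_Iio.2 hβ₀⟩ : Below κ))
      fun α hα => by
        by_contra hle
        refine hα (if_neg fun hlt => hle (Set.mem_Iic.2 (Subtype.coe_le_coe.1 hlt.le)))).trans_lt
      (mk_Iic_lt_lift hκ _)⟩
  obtain ⟨d, hdD, hd⟩ := hD t₀
  obtain ⟨μ, hμ, hb⟩ := exists_bound_of_mk_lt hκ (fun α : {α | d.val α ≠ none} => (α.1 : Ordinal.{u}))
    ((Cardinal.lift_id'.{u, u + 1} _).trans_lt d.card_dom_lt) fun α => α.1.2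
  -- The target index passes the whole domain of `d`; places where `d` is undefined receive the bit
  -- `0`.
  obtain ⟨q, hq, u, hu, h1, h2⟩ := h (max β₀ (Order.succ μ)) (le_max_left _ _)
    (max_lt hβ₀ (hlim.succ_lt hμ)) (fun ξ => ∃ h : ξ < κ.ord, d.val ⟨ξ, h⟩ = some 1) fun ξ hξ => by
      have := hd ⟨ξ, hξ.trans hβ₀⟩ _ (if_pos hξ)
      simp only [this, hξ.trans hβ₀]
      simp
  refine ⟨q, hq, d, hdD, mem_cohenFilter.2 fun α i hi => ?_⟩
  have hα : (α : Ordinal) < max β₀ (Order.succ μ) :=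
    (Order.lt_succ_of_le (hb ⟨α, by simp [hi]⟩)).trans_le (le_max_right _ _)
  refine ((eval_oscFunction α i).iff hu (h1 ▸ limEnum_strictMono u hα)).2 (Iff.trans ?_ (h2 α hα).symm)
  have hsome : d.val α = some 1 ↔ i = 1 := by rw [hi, Option.some_inj]
  exact ⟨fun h => ⟨α.2, hsome.2 h⟩, fun ⟨_, h⟩ => hsome.1 h⟩

/-- The final segments are known to be in `F` only once a condition exists, hence the conditional
form of `hF`; every use has a condition at hand. -/
theorem isCohenName_oscFunction (hκ : κ.IsInaccessible)
    (hF : Nonempty (Miller F × Miller F) → ∀ α, Set.Ioi α ∈ F) :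
    IsCohenName (oscFunction (m₀ F) (m₁ F) (enumName F)) := by
  refine ⟨cohenFilter F, ⟨fun p r s q _ h => ?_, fun p r s q _ h q' hq' => ?_,
    fun D hD p q _ => ?_⟩, fun p α i => ⟨fun q _ h q' hq' => ⟨q', le_rfl, ?_⟩, fun q _ h => ?_⟩⟩
  · exact mem_cohenFilter.2 fun α i hi => mem_cohenFilter.1 h.1 α i (h.2 α i hi)
  · have hr := mem_cohenFilter.1 h.1
    have hs := mem_cohenFilter.1 h.2
    obtain ⟨t, h1, h2, h3⟩ := CohenCond.exists_common_extension hκ r s fun α i j hi hj =>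
      eq_of_mem_oscFunction hκ (hF ⟨p⟩) (hr α i hi) (hs α j hj)
    refine ⟨q', le_rfl, t, mem_cohenFilter.2 fun α i hi => (regular_mem _ _).mono hq' ?_, h1, h2⟩
    exact (h3 α i hi).elim (hr α i) (hs α i)
  · obtain ⟨r, hr, d, hd, h⟩ := exists_dense_mem_cohenFilter hκ (hF ⟨p⟩) hD q
    exact ⟨r, hr, d, hd, h⟩
  -- A single value of `c` is witnessed by the Cohen condition with one-point domain.
  · classical
    refine ⟨⟨fun β => if β = α then some i else none, ?_⟩,
      mem_cohenFilter.2 fun β j hj => ?_, if_pos rfl⟩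
    · refine (Cardinal.mk_le_mk_of_subset (t := Set.Iic α) fun β hβ => ?_).trans_lt
        (mk_Iic_lt_lift hκ α)
      by_contra hle
      exact hβ (if_neg fun h => hle (Set.mem_Iic.2 h.le))
    · by_cases hβ : β = α
      · subst hβ
        have : i = j := by simpa using hj
        exact this ▸ (regular_mem _ _).mono hq' h
      · simp [hβ] at hj
  · refine (regular_mem _ _).of_dense fun q' hq' => ?_
    obtain ⟨r, hr, s, hs, hi⟩ := h q' hq'
    exact ⟨r, hr, mem_cohenFilter.1 hs α i hi⟩

end Forced

end KappaForcing

theorem mainTheorem9 (κ : Cardinal.{u}) (hκ : κ.IsInaccessible)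
    (F : Filter (KappaForcing.Below κ)) (hproper : F.NeBot)
    (hnonprincipal : ∀ Y : Set (KappaForcing.Below κ), F ≠ Filter.principal Y)
    (hcomplete : CardinalInterFilter F (Cardinal.lift.{u + 1} κ))
    (hnormal : KappaForcing.IsNormalFilter F) :
    Forcing.Forced (Forcing.isFunction (KappaForcing.m₀ F)) ∧
    Forcing.Forced (Forcing.isFunction (KappaForcing.m₁ F)) ∧
    Forcing.Forced (KappaForcing.isUnbounded
      (KappaForcing.oscPoints (KappaForcing.m₀ F) (KappaForcing.m₁ F))) ∧
    Forcing.Forced (KappaForcing.isClub (KappaForcing.limitPoints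
      (KappaForcing.oscPoints (KappaForcing.m₀ F) (KappaForcing.m₁ F)))) ∧
    ∃ e : Forcing.SetName (KappaForcing.Miller F × KappaForcing.Miller F)
        (KappaForcing.Below κ × KappaForcing.Below κ),
      Forcing.Forced (KappaForcing.isEnumeration e (KappaForcing.limitPoints
        (KappaForcing.oscPoints (KappaForcing.m₀ F) (KappaForcing.m₁ F)))) ∧
      Forcing.Forced (Forcing.isFunction
        (KappaForcing.oscFunction (KappaForcing.m₀ F) (KappaForcing.m₁ F) e)) ∧
      KappaForcing.IsCohenName
        (KappaForcing.oscFunction (KappaForcing.m₀ F) (KappaForcing.m₁ F) e) := by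
  have hF : ∀ p : KappaForcing.Miller F × KappaForcing.Miller F, ∀ α, Set.Ioi α ∈ F :=
    fun p => p.1.2.Ioi_mem hκ hnonprincipal
  exact ⟨fun p => KappaForcing.evalFun_m₀.forces_isFunction hκ (hF p) p,
    fun p => KappaForcing.evalFun_m₁.forces_isFunction hκ (hF p) p,
    fun p => KappaForcing.forces_isUnbounded_oscPoints hκ (hF p) p,
    fun p => KappaForcing.forces_isClub_limitPoints hκ (hF p) p, KappaForcing.enumName F,
    fun p => KappaForcing.forces_isEnumeration hκ (hF p) p,
    fun p => KappaForcing.forces_isFunction_oscFunction hκ (hF p) p,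
    KappaForcing.isCohenName_oscFunction hκ fun ⟨p⟩ => hF p⟩
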